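/- Let $F_1$ be the Grötzsch graph: its vertices are $v_{13},v_{23},v_1,v_2,x,u_1,u_2,u_3,w_{13},w_{23},y$; the vertices $u_1,u_2,w_{23},u_3,w_{13}$ form, in this order, a 5-cycle; $y$ is adjacent to exactly $v_{13},v_{23},v_1,v_2,x$; and, besides $y$, $v_2$ is adjacent to exactly $u_2,w_{13}$; $v_1$ to $u_1,w_{23}$; $v_{23}$ to $u_2,u_3$; $x$ to $w_{13},w_{23}$; and $v_{13}$ to $u_1,u_3$. For $s,t\ge 0$ let $F_1(s,t)$ be the graph obtained from $F_1$ by replacing $x$ and $y$ with independent sets of sizes $s$ and $t$, respectively, where two vertices are adjacent if and only if the corresponding vertices of $F_1$ are adjacent. Let $\rho(G)$ denote the spectral radius of the adjacency matrix of $G$, $\chi(G)$ the chromatic number and $e(G)$ the number of edges. There is an $N$ such that for every $n\ge N$ the graph $F^\ast=F_1\big(\lfloor\frac{n-11}{2}\rfloor,\lceil\frac{n-7}{2}\rceil\big)$ has the following properties. It is an $n$-vertex triangle-free graph with $\chi(F^\ast)\ge 4$. Every $n$-vertex triangle-free graph $G$ with $\chi(G)\ge 4$ satisfies $\rho(G)\le\rho(F^\ast)$,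 with equality if and only if $G\cong F^\ast$. Moreover, $F^\ast$ is also edge-extremal: every $n$-vertex triangle-free graph $G$ with $\chi(G)\ge 4$ satisfies $e(G)\le e(F^\ast)$. -/

import Mathlib

open scoped ENNReal

/-- The eleven vertices of the Grötzsch graph `F₁`. -/
inductive GrotzschVertex where
  | v13 | v23 | v1 | v2 | x | u1 | u2 | u3 | w13 | w23 | y
  deriving DecidableEq

open GrotzschVertex in
instance : Fintype GrotzschVertex where
  elems := {v13, v23, v1, v2, x, u1, u2, u3, w13, w23, y}
  complete := by intro a; cases a <;> decide

open GrotzschVertex in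
/-- The list of the twenty edges of the Grötzsch graph `F₁`. It is the Mycielskian of the 5-cycle
`u1 u2 w23 u3 w13`: the vertices `v2, v1, v23, x, v13` are the copies of these five cycle vertices
(in this order), and `y` is the vertex that is joined to the five copies. -/
def grotzschEdges : Finset (Sym2 GrotzschVertex) :=
  {s(u1, u2), s(u2, w23), s(w23, u3), s(u3, w13), s(w13, u1),
   s(v2, u2), s(v2, w13),
   s(v1, u1), s(v1, w23),
   s(v23, u2), s(v23, u3),
   s(x, w13), s(x, w23),
   s(v13, u1), s(v13, u3),
   s(y, v13), s(y, v23), s(y, v1), s(y, v2), s(y, x)}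

/-- The Grötzsch graph `F₁`. -/
def grotzsch : SimpleGraph GrotzschVertex :=
  SimpleGraph.fromEdgeSet (grotzschEdges : Set (Sym2 GrotzschVertex))

/-- The blow-up of `H`: every vertex `v` is replaced by an independent set of `m v` vertices, and
two vertices are adjacent if and only if the vertices of `H` they come from are adjacent. -/
def blowUp {V : Type*} (H : SimpleGraph V) (m : V → ℕ) : SimpleGraph (Σ v : V, Fin (m v)) :=
  H.comap Sigma.fst

/-- The number of copies of each vertex of the Grötzsch graph in `F₁(s, t)`. -/
def F1Size (s t : ℕ) : GrotzschVertex → ℕ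
  | GrotzschVertex.x => s
  | GrotzschVertex.y => t
  | _ => 1

/-- The graph `F₁(s, t)`: in the Grötzsch graph, `x` and `y` are replaced by independent sets of
sizes `s` and `t`. -/
def F1 (s t : ℕ) : SimpleGraph (Σ v : GrotzschVertex, Fin (F1Size s t v)) :=
  blowUp grotzsch (F1Size s t)

open scoped Classical in
/-- The (adjacency) spectral radius `ρ(G)`: the largest modulus of an eigenvalue of the adjacency
matrix. The matrix is real symmetric, so all its eigenvalues are real. -/
noncomputable def graphSpectralRadius {V : Type*} [Fintype V] (G : SimpleGraph V) : ℝ≥0∞ :=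
  spectralRadius ℝ (G.adjMatrix ℝ)

/-- Triangle-free graphs with chromatic number at least four. -/
def TriangleFreeChiGeFour {V : Type*} (G : SimpleGraph V) : Prop :=
  G.CliqueFree 3 ∧ 4 ≤ G.chromaticNumber

/-! Split the vertices into independent sets P, Q and a remainder R, with p = |P|, q = |Q|, and let
ℓ count the non-adjacent pairs in P × Q. If |R| ≤ 3 and the triangle-free graph is not 3-colourable,
explicit recolourings force R = {u1, u2, u3} with the single edge u1u2, and common neighbours of u3
with each of u1, u2 on both sides (`exists_grotzschCore`). Triangle-freeness then turns neighbours
of R into missing pairs: R sends at most ℓ + 4 edges to P ∪ Q, so e ≤ pq + 5; moreover ℓ ≥ 6, and ℓ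
= 6 only for blow-ups F₁(p - 4, q - 2) or F₁(q - 4, p - 2) (`GrotzschCore.card_missing`). Since p +
q = n - 3, the edge bound follows once dense graphs are shown to have such a partition
(`exists_nearBipartition`).

For the spectral radius, a test vector gives ρ(F*)² ≥ p₀q₀ - 12, where p₀, q₀ are the balanced side
sizes. A competitor with ρ at least this large has ρ² within a constant of the edge bound. Counting
walks of length two from a maximum of its Perron vector shows that the entries are almost constant
off at most three vertices of low degree (`PerronVector.exists_densePartition`). Feeding this back
into the eigenvalue equations gives ρ² ≤ pq - 2ℓ + 0.1 (`DensePartition.sq_le`). As ℓ ≥ 6 and pq ≤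
p₀q₀ are integers, ℓ = 6 and pq = p₀q₀.

When the two sides have different sizes, two candidates survive, F₁(s, s + 3) and F₁(s + 1, s + 2),
which this estimate cannot separate. Their characteristic equations, reduced to the classes of x and
y, are compared exactly in `graphIndex_F1_lt`. -/

/-! ### Rayleigh quotients and the spectral radius of a graph. -/

section SpectralBasics
open Finset
open scoped Classical

variable {V : Type*} [Fintype V]

/-- The quadratic form of the adjacency matrix. -/
noncomputable def adjForm (G : SimpleGraph V) (z : V → ℝ) : ℝ :=
  ∑ v, ∑ w ∈ G.neighborFinset v, z v * z w

theorem sum_neighborFinset_eq_sum_ite (G : SimpleGraph V) (v : V) (f : V → ℝ) :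
    ∑ w ∈ G.neighborFinset v, f w = ∑ w, if G.Adj v w then f w else 0 := by
  rw [← Finset.sum_filter]
  congr 1
  ext w
  simp

theorem sum_sum_neighborFinset_comm (G : SimpleGraph V) (f : V → V → ℝ) :
    ∑ v, ∑ w ∈ G.neighborFinset v, f v w = ∑ v, ∑ w ∈ G.neighborFinset v, f w v := by
  simp only [sum_neighborFinset_eq_sum_ite]
  rw [Finset.sum_comm]
  simp only [G.adj_comm]

theorem adjForm_add_smul (G : SimpleGraph V) (z w : V → ℝ) (t : ℝ) :
    adjForm G (fun v => z v + t * w v) =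
      adjForm G z + 2 * t * (∑ v, w v * ∑ x ∈ G.neighborFinset v, z x) + t ^ 2 * adjForm G w := by
  have h := sum_sum_neighborFinset_comm G (fun v x => z v * w x)
  have e : ∀ v, w v * ∑ x ∈ G.neighborFinset v, z x = ∑ x ∈ G.neighborFinset v, z x * w v := by
    intro v
    rw [Finset.mul_sum]
    exact Finset.sum_congr rfl fun x _ => mul_comm _ _
  have h2 : adjForm G (fun v => z v + t * w v) =
      adjForm G z + t * (∑ v, ∑ x ∈ G.neighborFinset v, z v * w x)
        + t * (∑ v, ∑ x ∈ G.neighborFinset v, z x * w v) + t ^ 2 * adjForm G w := by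
    unfold adjForm
    simp only [Finset.mul_sum, ← Finset.sum_add_distrib]
    refine Finset.sum_congr rfl fun v _ => Finset.sum_congr rfl fun x _ => ?_
    ring
  rw [h2, h]
  simp only [e]
  ring

theorem adjForm_le_abs (G : SimpleGraph V) (z : V → ℝ) :
    |adjForm G z| ≤ adjForm G (fun v => |z v|) := by
  unfold adjForm
  refine (Finset.abs_sum_le_sum_abs _ _).trans (Finset.sum_le_sum fun v _ => ?_)
  refine (Finset.abs_sum_le_sum_abs _ _).trans (Finset.sum_le_sum fun w _ => ?_)
  rw [abs_mul]

theorem adjForm_smul (G : SimpleGraph V) (z : V → ℝ) (c : ℝ) :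
    adjForm G (fun v => c * z v) = c ^ 2 * adjForm G z := by
  unfold adjForm
  simp only [Finset.mul_sum]
  refine Finset.sum_congr rfl fun v _ => Finset.sum_congr rfl fun x _ => ?_
  ring

theorem sum_sq_pos {z : V → ℝ} (hz : z ≠ 0) : 0 < ∑ v, z v ^ 2 := by
  obtain ⟨v, hv⟩ := Function.ne_iff.1 hz
  exact Finset.sum_pos' (fun _ _ => sq_nonneg _) ⟨v, mem_univ _, sq_pos_of_ne_zero hv⟩

/-- Compactness of the unit sphere gives a maximiser; replacing its entries by absolute values does
not decrease the form, hence nonnegativity. -/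
theorem exists_max_adjForm [Nonempty V] (G : SimpleGraph V) :
    ∃ (ρ : ℝ) (z : V → ℝ), (∀ v, 0 ≤ z v) ∧ z ≠ 0 ∧ adjForm G z = ρ * ∑ v, z v ^ 2 ∧
      ∀ y : V → ℝ, adjForm G y ≤ ρ * ∑ v, y v ^ 2 := by
  have hc : IsCompact {z : V → ℝ | ∑ v, z v ^ 2 = 1} := by
    refine (isCompact_Icc (a := fun _ : V => (-1 : ℝ)) (b := fun _ => 1)).of_isClosed_subset ?_ ?_
    · exact isClosed_eq (by fun_prop) continuous_const
    · intro z hz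
      have h1 : ∀ v, z v ^ 2 ≤ 1 := fun v => by
        rw [← (show ∑ v, z v ^ 2 = 1 from hz)]
        exact Finset.single_le_sum (f := fun v => z v ^ 2) (fun _ _ => sq_nonneg _) (mem_univ v)
      exact ⟨fun v => (abs_le.1 ((sq_le_one_iff_abs_le_one _).1 (h1 v))).1,
        fun v => (abs_le.1 ((sq_le_one_iff_abs_le_one _).1 (h1 v))).2⟩
  have hne : {z : V → ℝ | ∑ v, z v ^ 2 = 1}.Nonempty := by
    obtain ⟨v0⟩ := ‹Nonempty V›
    exact ⟨Pi.single v0 1, by simp [Pi.single_apply]⟩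
  have hcont : ContinuousOn (adjForm G) {z : V → ℝ | ∑ v, z v ^ 2 = 1} := by
    unfold adjForm
    fun_prop
  obtain ⟨z, hz, hmax⟩ := hc.exists_isMaxOn hne hcont
  have hz1 : ∑ v, |z v| ^ 2 = 1 := by simpa using hz
  have hle : ∀ y : V → ℝ, adjForm G y ≤ adjForm G z * ∑ v, y v ^ 2 := by
    intro y
    by_cases hy : y = 0
    · subst hy
      simp [adjForm]
    have hpos := sum_sq_pos hy
    set c := (Real.sqrt (∑ v, y v ^ 2))⁻¹ with hcdef
    have hc2 : c ^ 2 * ∑ v, y v ^ 2 = 1 := by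
      rw [hcdef, inv_pow, Real.sq_sqrt hpos.le, inv_mul_cancel₀ hpos.ne']
    have hm : adjForm G (fun v => c * y v) ≤ adjForm G z := by
      apply hmax
      simp only [Set.mem_ofPred_eq, mul_pow, ← Finset.mul_sum]
      exact hc2
    rw [adjForm_smul] at hm
    calc adjForm G y = (c ^ 2 * adjForm G y) * ∑ v, y v ^ 2 := by
          rw [mul_right_comm, hc2, one_mul]
      _ ≤ _ := by gcongr
  refine ⟨adjForm G z, fun v => |z v|, fun v => abs_nonneg _, ?_, ?_, hle⟩
  · intro h
    have : ∀ v, |z v| = 0 := fun v => congrFun h v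
    simp [this] at hz1
  · rw [hz1, mul_one]
    refine le_antisymm ?_ ((le_abs_self _).trans (adjForm_le_abs G z))
    have := hle (fun v => |z v|)
    rwa [hz1, mul_one] at this

theorem eigen_of_max_adjForm {G : SimpleGraph V} {ρ : ℝ} {z : V → ℝ}
    (hz : adjForm G z = ρ * ∑ v, z v ^ 2)
    (hmax : ∀ y : V → ℝ, adjForm G y ≤ ρ * ∑ v, y v ^ 2) (v : V) :
    ∑ w ∈ G.neighborFinset v, z w = ρ * z v := by
  set y : V → ℝ := Pi.single v 1 with hy
  set b := ρ * z v - ∑ w ∈ G.neighborFinset v, z w with hb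
  set g := ρ * ∑ v, y v ^ 2 - adjForm G y with hg
  have key : ∀ t : ℝ, 0 ≤ 2 * t * b + t ^ 2 * g := by
    intro t
    have h := hmax (fun v => z v + t * y v)
    rw [adjForm_add_smul] at h
    have e1 : ∑ x, y x * ∑ w ∈ G.neighborFinset x, z w = ∑ w ∈ G.neighborFinset v, z w := by
      simp [hy, Pi.single_apply]
    have e2 : ∑ x, (z x + t * y x) ^ 2 = ∑ x, z x ^ 2 + 2 * t * z v + t ^ 2 * ∑ x, y x ^ 2 := by
      have : ∑ x, z x * y x = z v := by simp [hy, Pi.single_apply]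
      rw [← this]
      simp only [Finset.mul_sum, ← Finset.sum_add_distrib]
      exact Finset.sum_congr rfl fun x _ => by ring
    rw [e1, e2, hz] at h
    rw [hb, hg]
    linarith
  have hg0 : 0 ≤ g := by have := hmax y; rw [hg]; linarith
  have hb0 : b = 0 := by
    by_contra hne
    -- The first variation b must vanish: this step makes 2tb + t²g negative if b ≠ 0. The
    -- denominator g + 1 also covers g = 0.
    have h := key (-b / (g + 1))
    have : 2 * (-b / (g + 1)) * b + (-b / (g + 1)) ^ 2 * g = - (b ^ 2 * (g + 2)) / (g + 1) ^ 2 := by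
      field_simp
      ring
    rw [this] at h
    have : 0 < b ^ 2 * (g + 2) / (g + 1) ^ 2 := by positivity
    rw [neg_div] at h
    linarith
  linarith

/-- The spectral radius of a graph as a real number. -/
noncomputable def graphIndex (G : SimpleGraph V) : ℝ := (graphSpectralRadius G).toReal

theorem graphSpectralRadius_eq_of_max [Nonempty V] {G : SimpleGraph V} {ρ : ℝ} {z : V → ℝ}
    (hz0 : z ≠ 0) (hz : adjForm G z = ρ * ∑ v, z v ^ 2)
    (hmax : ∀ y : V → ℝ, adjForm G y ≤ ρ * ∑ v, y v ^ 2) (hρ : 0 ≤ ρ) :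
    graphSpectralRadius G = ENNReal.ofReal ρ := by
  have hspec : ∀ μ : ℝ, μ ∈ spectrum ℝ (G.adjMatrix ℝ) ↔
      ∃ y : V → ℝ, y ≠ 0 ∧ ∀ v, ∑ w ∈ G.neighborFinset v, y w = μ * y v := by
    intro μ
    rw [← Matrix.spectrum_toLin', ← Module.End.hasEigenvalue_iff_mem_spectrum]
    constructor
    · intro h
      obtain ⟨y, hy⟩ := h.exists_hasEigenvector
      refine ⟨y, hy.2, fun v => ?_⟩
      have := congrFun hy.apply_eq_smul v
      simpa [SimpleGraph.adjMatrix_mulVec_apply] using this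
    · rintro ⟨y, hy0, hy⟩
      refine Module.End.hasEigenvalue_of_hasEigenvector (x := y) ⟨?_, hy0⟩
      rw [Module.End.mem_eigenspace_iff]
      ext v
      simpa [SimpleGraph.adjMatrix_mulVec_apply] using hy v
  have hof : ENNReal.ofReal ρ = (‖ρ‖₊ : ℝ≥0∞) := by
    rw [← enorm_eq_nnnorm, Real.enorm_eq_ofReal hρ]
  unfold graphSpectralRadius spectralRadius
  rw [hof]
  apply le_antisymm
  · refine iSup₂_le fun μ hμ => ?_
    obtain ⟨y, hy0, hy⟩ := (hspec μ).1 hμ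
    have h1 : adjForm G y = μ * ∑ v, y v ^ 2 := by
      unfold adjForm
      simp only [← Finset.mul_sum, hy]
      rw [Finset.mul_sum]
      exact Finset.sum_congr rfl fun v _ => by ring
    have h2 := (adjForm_le_abs G y).trans (hmax _)
    have hpos := sum_sq_pos hy0
    simp only [sq_abs] at h2
    rw [h1, abs_mul, abs_of_pos hpos] at h2
    have h3 : |μ| ≤ ρ := le_of_mul_le_mul_right h2 hpos
    have : ‖μ‖₊ ≤ ‖ρ‖₊ := by
      rw [← NNReal.coe_le_coe]
      simpa [abs_of_nonneg hρ] using h3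
    exact_mod_cast this
  · exact le_iSup₂ (f := fun (k : ℝ) (_ : k ∈ spectrum ℝ (G.adjMatrix ℝ)) => (‖k‖₊ : ℝ≥0∞)) ρ
      ((hspec ρ).2 ⟨z, hz0, eigen_of_max_adjForm hz hmax⟩)

theorem graphIndex_spec [Nonempty V] (G : SimpleGraph V) :
    0 ≤ graphIndex G ∧ graphSpectralRadius G = ENNReal.ofReal (graphIndex G) ∧
      (∃ z : V → ℝ, (∀ v, 0 ≤ z v) ∧ z ≠ 0 ∧
        ∀ v, ∑ w ∈ G.neighborFinset v, z w = graphIndex G * z v) ∧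
      ∀ y : V → ℝ, adjForm G y ≤ graphIndex G * ∑ v, y v ^ 2 := by
  obtain ⟨ρ, z, hz, hz0, hzρ, hmax⟩ := exists_max_adjForm G
  have hρ : 0 ≤ ρ := by
    have h : 0 ≤ adjForm G z := Finset.sum_nonneg fun v _ => Finset.sum_nonneg fun w _ =>
      mul_nonneg (hz v) (hz w)
    rw [hzρ] at h
    exact nonneg_of_mul_nonneg_left h (sum_sq_pos hz0)
  have hs := graphSpectralRadius_eq_of_max hz0 hzρ hmax hρ
  have hi : graphIndex G = ρ := by rw [graphIndex, hs, ENNReal.toReal_ofReal hρ]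
  rw [hi]
  exact ⟨hρ, hs, ⟨z, hz, hz0, eigen_of_max_adjForm hzρ hmax⟩, hmax⟩

theorem graphSpectralRadius_congr {W : Type*} [Fintype W] {G : SimpleGraph V} {H : SimpleGraph W}
    (e : G ≃g H) : graphSpectralRadius G = graphSpectralRadius H := by
  have hm : Matrix.reindexAlgEquiv ℝ ℝ e.toEquiv (G.adjMatrix ℝ) = H.adjMatrix ℝ := by
    ext a b
    simp only [Matrix.coe_reindexAlgEquiv, Matrix.reindex_apply, Matrix.submatrix_apply,
      SimpleGraph.adjMatrix_apply]
    congr 1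
    rw [← e.map_adj_iff]
    exact (congrArg₂ H.Adj (e.apply_symm_apply a) (e.apply_symm_apply b))
  unfold graphSpectralRadius spectralRadius
  rw [← hm, AlgEquiv.spectrum_eq]

end SpectralBasics

/-! ### Near-bipartitions and obstructions to 3-colouring. -/

section Colouring
open Finset
open scoped Classical

variable {V : Type*}

/-- The vertex set is split into two independent sets `P`, `Q` and a remainder `R`. -/
structure NearBipartition (G : SimpleGraph V) (P Q R : Finset V) : Prop where
  indepP : ∀ x ∈ P, ∀ y ∈ P, ¬ G.Adj x y
  indepQ : ∀ x ∈ Q, ∀ y ∈ Q, ¬ G.Adj x y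
  cover : ∀ v, v ∈ P ∨ v ∈ Q ∨ v ∈ R
  disjPQ : Disjoint P Q
  disjPR : Disjoint P R
  disjQR : Disjoint Q R

namespace NearBipartition

variable {G : SimpleGraph V} {P Q R : Finset V}

theorem symm (h : NearBipartition G P Q R) : NearBipartition G Q P R :=
  ⟨h.indepQ, h.indepP, fun v => by have := h.cover v; tauto, h.disjPQ.symm, h.disjQR, h.disjPR⟩

theorem notMem_of_memP (h : NearBipartition G P Q R) {v : V} (hv : v ∈ P) : v ∉ Q ∧ v ∉ R :=
  ⟨Finset.disjoint_left.1 h.disjPQ hv, Finset.disjoint_left.1 h.disjPR hv⟩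

theorem notMem_of_memQ (h : NearBipartition G P Q R) {v : V} (hv : v ∈ Q) : v ∉ P ∧ v ∉ R :=
  h.symm.notMem_of_memP hv

theorem notMem_of_memR (h : NearBipartition G P Q R) {v : V} (hv : v ∈ R) : v ∉ P ∧ v ∉ Q :=
  ⟨Finset.disjoint_right.1 h.disjPR hv, Finset.disjoint_right.1 h.disjQR hv⟩

end NearBipartition

theorem colorable_three_of_fun {G : SimpleGraph V} (c : V → Fin 3)
    (h : ∀ v w, G.Adj v w → c v ≠ c w) : G.Colorable 3 :=
  ⟨SimpleGraph.Coloring.mk c fun {v w} hvw => h v w hvw⟩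

theorem not_adj_of_common {G : SimpleGraph V} (hG : G.CliqueFree 3) {a b c : V}
    (hab : G.Adj a b) (hac : G.Adj a c) : ¬ G.Adj b c := fun hbc =>
  hG {a, b, c} (SimpleGraph.is3Clique_triple_iff.2 ⟨hab, hac, hbc⟩)

variable {G : SimpleGraph V} {P Q R : Finset V}

theorem colorable_of_indep_rest (h : NearBipartition G P Q R)
    (hR : ∀ v ∈ R, ∀ w ∈ R, ¬ G.Adj v w) : G.Colorable 3 := by
  refine colorable_three_of_fun (fun v => if v ∈ P then 0 else if v ∈ Q then 1 else 2) ?_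
  intro v w hvw
  have h1 : v ∈ P → w ∉ P := fun hv hw => h.indepP v hv w hw hvw
  have h2 : v ∈ Q → w ∉ Q := fun hv hw => h.indepQ v hv w hw hvw
  have h3 : v ∈ R → w ∉ R := fun hv hw => hR v hv w hw hvw
  have h4 := h.cover v
  have h5 := h.cover w
  split_ifs <;> simp_all

/-- If all of `R` except `r` can share a colour with `P ∩ N(r)`, the graph is 3-colourable. -/
theorem colorable_of_swap (h : NearBipartition G P Q R) (hG : G.CliqueFree 3) {r : V} (hr : r ∈ R)
    (hR : ∀ v ∈ R, ∀ w ∈ R, v ≠ r → w ≠ r → ¬ G.Adj v w)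
    (hx : ∀ v ∈ R, v ≠ r → ∀ x ∈ P, G.Adj r x → ¬ G.Adj v x) : G.Colorable 3 := by
  have hrP := (h.notMem_of_memR hr).1
  have hrQ := (h.notMem_of_memR hr).2
  -- Colour 0 goes to r and the part of P not adjacent to r; colour 2 to N(r) ∩ P together with the
  -- rest of R.
  refine colorable_three_of_fun (fun v => if v ∈ Q then 1 else
    if (v ∈ P ∧ ¬ G.Adj r v) ∨ v = r then 0 else 2) ?_
  intro v w hvw
  have h1 : v ∈ P → w ∉ P := fun hv hw => h.indepP v hv w hw hvw
  have h2 : v ∈ Q → w ∉ Q := fun hv hw => h.indepQ v hv w hw hvw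
  have h4 := h.cover v
  have h5 := h.cover w
  have h6 : v ∈ R → w ∈ R → v ≠ r → w ≠ r → False :=
    fun hv hw h1 h2 => hR v hv w hw h1 h2 hvw
  have h7 := hx v
  have h8 := hx w
  have h9 : G.Adj r v → ¬ G.Adj r w := fun a b => not_adj_of_common hG a b hvw
  have h10 := hvw.symm
  have h11 : v ≠ w := hvw.ne
  split_ifs <;> grind

/-- The seven vertices around the exceptional set of a non-3-colourable graph. -/
structure GrotzschCore (G : SimpleGraph V) (P Q R : Finset V)
    (u1 u2 u3 v13 v23 w13 w23 : V) : Prop where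
  eqR : R = {u1, u2, u3}
  ne13 : u1 ≠ u3
  ne23 : u2 ≠ u3
  adj12 : G.Adj u1 u2
  nadj13 : ¬ G.Adj u1 u3
  nadj23 : ¬ G.Adj u2 u3
  v13P : v13 ∈ P
  v23P : v23 ∈ P
  w13Q : w13 ∈ Q
  w23Q : w23 ∈ Q
  av13_1 : G.Adj u1 v13
  av13_3 : G.Adj u3 v13
  av23_2 : G.Adj u2 v23
  av23_3 : G.Adj u3 v23
  aw13_1 : G.Adj u1 w13
  aw13_3 : G.Adj u3 w13
  aw23_2 : G.Adj u2 w23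
  aw23_3 : G.Adj u3 w23

/-- Each missing feature of the core would permit either the colouring with R as third class or the
one of `colorable_of_swap` at a suitable vertex of R. -/
theorem exists_grotzschCore (h : NearBipartition G P Q R) (hG : G.CliqueFree 3)
    (hχ : ¬ G.Colorable 3) (hR : R.card ≤ 3) :
    ∃ u1 u2 u3 v13 v23 w13 w23, GrotzschCore G P Q R u1 u2 u3 v13 v23 w13 w23 := by
  have hedge : ∃ u1 ∈ R, ∃ u2 ∈ R, G.Adj u1 u2 := by
    by_contra hcon
    push Not at hcon
    exact hχ (colorable_of_indep_rest h hcon)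
  obtain ⟨u1, hu1, u2, hu2, h12⟩ := hedge
  have hu3 : ∃ u3 ∈ R, u3 ≠ u1 ∧ u3 ≠ u2 := by
    by_contra hcon
    push Not at hcon
    refine hχ (colorable_of_swap h hG hu1 ?_ ?_)
    · intro v hv w hw hv1 hw1 hvw
      exact hvw.ne ((hcon v hv hv1).trans (hcon w hw hw1).symm)
    · intro v hv hv1 x _ hx
      rw [hcon v hv hv1]
      exact fun hvx => not_adj_of_common hG h12.symm hvx hx
  obtain ⟨u3, hu3, h31, h32⟩ := hu3
  have hRe : R = {u1, u2, u3} := by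
    symm
    apply Finset.eq_of_subset_of_card_le
    · intro v hv
      simp only [Finset.mem_insert, Finset.mem_singleton] at hv
      rcases hv with rfl | rfl | rfl <;> assumption
    · rw [Finset.card_eq_three.2 ⟨u1, u2, u3, h12.ne, h31.symm, h32.symm, rfl⟩]
      exact hR
  -- Swapping at a fails only because of a common neighbour in A of a and another vertex of R; this
  -- cannot be b, which is adjacent to a, so it is u3.
  have key : ∀ {A B : Finset V} {a b : V}, NearBipartition G A B R → R = {a, b, u3} → G.Adj a b →
      a ≠ u3 → b ≠ u3 → ¬ G.Adj b u3 → ∃ x ∈ A, G.Adj a x ∧ G.Adj u3 x := by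
    intro A B a b hAB hRab hab ha3 hb3 hbu
    by_contra hcon
    push Not at hcon
    have haR : a ∈ R := by rw [hRab]; simp
    refine hχ (colorable_of_swap hAB hG haR ?_ ?_)
    · intro v hv w hw hva hwa hvw
      have := hvw.ne
      have := hvw.symm
      simp only [hRab, Finset.mem_insert, Finset.mem_singleton] at hv hw
      grind
    · intro v hv hva x hx hax hvx
      simp only [hRab, Finset.mem_insert, Finset.mem_singleton] at hv
      rcases hv with rfl | rfl | rfl
      · exact hva rfl
      · exact not_adj_of_common hG hab hax hvx
      · exact hcon x hx hax hvx
  -- If b were adjacent to both other vertices of R, it would share no neighbour with either, and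
  -- swapping at b would give a colouring.
  have key2 : ∀ {a b : V}, R = {a, b, u3} → G.Adj a b → a ≠ u3 → b ≠ u3 → ¬ G.Adj b u3 := by
    intro a b hRab hab ha3 hb3 hbu
    have hbR : b ∈ R := by rw [hRab]; simp
    refine hχ (colorable_of_swap h hG hbR ?_ ?_)
    · intro v hv w hw hvb hwb hvw
      have := not_adj_of_common hG hab.symm hbu
      have := hvw.ne
      have := hvw.symm
      simp only [hRab, Finset.mem_insert, Finset.mem_singleton] at hv hw
      grind
    · intro v hv hvb x hx hbx hvx
      simp only [hRab, Finset.mem_insert, Finset.mem_singleton] at hv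
      rcases hv with rfl | rfl | rfl
      · exact not_adj_of_common hG hab.symm hbx hvx
      · exact hvb rfl
      · exact not_adj_of_common hG hbu hbx hvx
  have hRe' : R = {u2, u1, u3} := by rw [hRe]; grind
  have n23 := key2 hRe h12 h31.symm h32.symm
  have n13 := key2 hRe' h12.symm h32.symm h31.symm
  obtain ⟨v13, a1, a2, a3⟩ := key h hRe h12 h31.symm h32.symm n23
  obtain ⟨w13, b1, b2, b3⟩ := key h.symm hRe h12 h31.symm h32.symm n23
  obtain ⟨v23, c1, c2, c3⟩ := key h hRe' h12.symm h32.symm h31.symm n13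
  obtain ⟨w23, d1, d2, d3⟩ := key h.symm hRe' h12.symm h32.symm h31.symm n13
  exact ⟨u1, u2, u3, v13, v23, w13, w23, hRe, h31.symm, h32.symm, h12, n13, n23,
    a1, c1, b1, d1, a2, a3, c2, c3, b2, b3, d2, d3⟩

namespace GrotzschCore

variable {u1 u2 u3 v13 v23 w13 w23 : V}

theorem symm (c : GrotzschCore G P Q R u1 u2 u3 v13 v23 w13 w23) :
    GrotzschCore G Q P R u1 u2 u3 w13 w23 v13 v23 where
  eqR := c.eqR
  ne13 := c.ne13
  ne23 := c.ne23
  adj12 := c.adj12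
  nadj13 := c.nadj13
  nadj23 := c.nadj23
  v13P := c.w13Q
  v23P := c.w23Q
  w13Q := c.v13P
  w23Q := c.v23P
  av13_1 := c.aw13_1
  av13_3 := c.aw13_3
  av23_2 := c.aw23_2
  av23_3 := c.aw23_3
  aw13_1 := c.av13_1
  aw13_3 := c.av13_3
  aw23_2 := c.av23_2
  aw23_3 := c.av23_3

theorem swap (c : GrotzschCore G P Q R u1 u2 u3 v13 v23 w13 w23) :
    GrotzschCore G P Q R u2 u1 u3 v23 v13 w23 w13 where
  eqR := by rw [c.eqR]; grind
  ne13 := c.ne23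
  ne23 := c.ne13
  adj12 := c.adj12.symm
  nadj13 := c.nadj23
  nadj23 := c.nadj13
  v13P := c.v23P
  v23P := c.v13P
  w13Q := c.w23Q
  w23Q := c.w13Q
  av13_1 := c.av23_2
  av13_3 := c.av23_3
  av23_2 := c.av13_1
  av23_3 := c.av13_3
  aw13_1 := c.aw23_2
  aw13_3 := c.aw23_3
  aw23_2 := c.aw13_1
  aw23_3 := c.aw13_3

theorem ne_v (c : GrotzschCore G P Q R u1 u2 u3 v13 v23 w13 w23) (hG : G.CliqueFree 3) :
    v13 ≠ v23 := by
  rintro rfl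
  exact not_adj_of_common hG c.adj12 c.av13_1 c.av23_2

theorem ne_w (c : GrotzschCore G P Q R u1 u2 u3 v13 v23 w13 w23) (hG : G.CliqueFree 3) :
    w13 ≠ w23 := c.symm.ne_v hG

/-- One of `N_P(u₁) ⊆ N(u₃)` and `N_Q(u₂) ⊆ N(u₃)` fails. -/
theorem exists_outside (c : GrotzschCore G P Q R u1 u2 u3 v13 v23 w13 w23)
    (h : NearBipartition G P Q R) (hG : G.CliqueFree 3) (hχ : ¬ G.Colorable 3) :
    (∃ x ∈ P, G.Adj u1 x ∧ ¬ G.Adj u3 x) ∨ ∃ y ∈ Q, G.Adj u2 y ∧ ¬ G.Adj u3 y := by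
  by_contra hcon
  push Not at hcon
  obtain ⟨hP, hQ⟩ := hcon
  apply hχ
  have hmem : ∀ v, v ∈ R ↔ v = u1 ∨ v = u2 ∨ v = u3 := fun v => by rw [c.eqR]; simp
  have m1 := h.notMem_of_memR ((hmem u1).2 (by simp))
  have m2 := h.notMem_of_memR ((hmem u2).2 (by simp))
  have m3 := h.notMem_of_memR ((hmem u3).2 (by simp))
  -- The neighbours of u3 outside R form one class; the others are the remainder of P with u1, u3
  -- and the remainder of Q with u2. The two assumed inclusions protect u1 and u2.
  refine colorable_three_of_fun (fun v => if v ∉ R ∧ G.Adj u3 v then 2 else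
    if v ∈ P ∨ v = u1 ∨ v = u3 then 0 else 1) ?_
  intro v w hvw
  have h1 : v ∈ P → w ∉ P := fun hv hw => h.indepP v hv w hw hvw
  have h2 : v ∈ Q → w ∉ Q := fun hv hw => h.indepQ v hv w hw hvw
  have h4 := h.cover v
  have h5 := h.cover w
  have h9 : G.Adj u3 v → ¬ G.Adj u3 w := fun a b => not_adj_of_common hG a b hvw
  have h10 := hvw.symm
  have h11 : v ≠ w := hvw.ne
  have h12 := c.adj12
  have h13 := c.nadj13
  have h14 := c.nadj23
  have h15 := c.adj12.symm
  have h16 : ¬ G.Adj u3 u1 := fun h => c.nadj13 h.symm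
  have h17 : ¬ G.Adj u3 u2 := fun h => c.nadj23 h.symm
  have h18 := c.ne13
  have h19 := c.ne23
  have h20 := hP v
  have h21 := hP w
  have h22 := hQ v
  have h23 := hQ w
  have h24 := hmem v
  have h25 := hmem w
  split_ifs <;> grind

end GrotzschCore

/-- The pairs of `P × Q` that are not edges. -/
noncomputable def missing (G : SimpleGraph V) (P Q : Finset V) : Finset (V × V) :=
  (P ×ˢ Q).filter fun e => ¬ G.Adj e.1 e.2

theorem mem_missing {e : V × V} : e ∈ missing G P Q ↔ (e.1 ∈ P ∧ e.2 ∈ Q) ∧ ¬ G.Adj e.1 e.2 := by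
  simp [missing]

theorem missing_swap (G : SimpleGraph V) (P Q : Finset V) :
    (missing G Q P).card = (missing G P Q).card := by
  refine Finset.card_bij (fun e _ => e.swap) ?_ ?_ ?_
  · intro e he
    rw [mem_missing] at he ⊢
    exact ⟨⟨he.1.2, he.1.1⟩, fun h => he.2 h.symm⟩
  · intro a _ b _ hab
    exact Prod.swap_injective hab
  · intro b hb
    rw [mem_missing] at hb
    exact ⟨b.swap, mem_missing.2 ⟨⟨hb.1.2, hb.1.1⟩, fun h => hb.2 h.symm⟩, Prod.swap_swap b⟩

end Colouring

/-! ### Edge counts in terms of missing pairs. -/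

section Counting
open Finset
open scoped Classical

variable {V : Type*}

/-- The number of neighbours of `v` in `S`. -/
noncomputable def degIn (G : SimpleGraph V) (S : Finset V) (v : V) : ℕ :=
  (S.filter (G.Adj v)).card

theorem degIn_le_card (G : SimpleGraph V) (S : Finset V) (v : V) : degIn G S v ≤ S.card :=
  Finset.card_filter_le _ _

theorem degIn_mono (G : SimpleGraph V) {S T : Finset V} (h : S ⊆ T) (v : V) :
    degIn G S v ≤ degIn G T v :=
  Finset.card_le_card (Finset.filter_subset_filter _ h)

theorem degIn_eq_zero {G : SimpleGraph V} {S : Finset V} {v : V} (h : ∀ w ∈ S, ¬ G.Adj v w) :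
    degIn G S v = 0 := by
  rw [degIn, Finset.card_eq_zero, Finset.filter_eq_empty_iff]
  exact fun {w} hw => h w hw

theorem degIn_union (G : SimpleGraph V) {S T : Finset V} (h : Disjoint S T) (v : V) :
    degIn G (S ∪ T) v = degIn G S v + degIn G T v := by
  rw [degIn, Finset.filter_union, Finset.card_union_of_disjoint]
  · rfl
  · exact Finset.disjoint_filter_filter h

theorem sum_degIn_comm (G : SimpleGraph V) (S T : Finset V) :
    ∑ x ∈ S, degIn G T x = ∑ y ∈ T, degIn G S y := by
  simp only [degIn, Finset.card_filter]
  rw [Finset.sum_comm]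
  simp only [G.adj_comm]

theorem sum_degIn_add_card_missing (G : SimpleGraph V) (P Q : Finset V) :
    ∑ x ∈ P, degIn G Q x + (missing G P Q).card = P.card * Q.card := by
  have h1 : ∑ x ∈ P, degIn G Q x = ((P ×ˢ Q).filter fun e => G.Adj e.1 e.2).card := by
    simp only [degIn, Finset.card_filter]
    rw [Finset.sum_product]
  rw [h1, missing, Finset.card_filter_add_card_filter_not, Finset.card_product]

theorem card_missing_eq_sum (G : SimpleGraph V) (P Q : Finset V) :
    (missing G P Q).card = ∑ x ∈ P, (Q.card - degIn G Q x) := by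
  have h := sum_degIn_add_card_missing G P Q
  have h2 : ∑ x ∈ P, (Q.card - degIn G Q x) + ∑ x ∈ P, degIn G Q x = P.card * Q.card := by
    rw [← Finset.sum_add_distrib, ← smul_eq_mul, ← Finset.sum_const]
    exact Finset.sum_congr rfl fun x _ => Nat.sub_add_cancel (degIn_le_card G Q x)
  omega

variable {G : SimpleGraph V} {P Q R : Finset V}

theorem degree_eq_degIn_univ [Fintype V] (G : SimpleGraph V) (v : V) : G.degree v = degIn G univ v := by
  rw [degIn, ← SimpleGraph.card_neighborFinset_eq_degree]
  congr 1
  ext w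
  simp

namespace NearBipartition

theorem univ_eq [Fintype V] (h : NearBipartition G P Q R) : (univ : Finset V) = P ∪ Q ∪ R := by
  ext v
  have := h.cover v
  simp only [mem_univ, mem_union, true_iff]
  tauto

theorem disj_union (h : NearBipartition G P Q R) : Disjoint (P ∪ Q) R :=
  Finset.disjoint_union_left.2 ⟨h.disjPR, h.disjQR⟩

theorem card_eq [Fintype V] (h : NearBipartition G P Q R) : Fintype.card V = P.card + Q.card + R.card := by
  rw [← Finset.card_univ, h.univ_eq, Finset.card_union_of_disjoint h.disj_union,
    Finset.card_union_of_disjoint h.disjPQ]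

theorem degree_eq [Fintype V] (h : NearBipartition G P Q R) (v : V) :
    G.degree v = degIn G P v + degIn G Q v + degIn G R v := by
  rw [degree_eq_degIn_univ, h.univ_eq, degIn_union G h.disj_union, degIn_union G h.disjPQ]

theorem sum_eq [Fintype V] {M : Type*} [AddCommMonoid M] (h : NearBipartition G P Q R) (f : V → M) :
    ∑ v, f v = ∑ v ∈ P, f v + ∑ v ∈ Q, f v + ∑ v ∈ R, f v := by
  rw [h.univ_eq, Finset.sum_union h.disj_union, Finset.sum_union h.disjPQ]

theorem degIn_P (h : NearBipartition G P Q R) {v : V} (hv : v ∈ P) : degIn G P v = 0 :=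
  degIn_eq_zero fun w hw => h.indepP v hv w hw

theorem degIn_Q (h : NearBipartition G P Q R) {v : V} (hv : v ∈ Q) : degIn G Q v = 0 :=
  degIn_eq_zero fun w hw => h.indepQ v hv w hw

theorem twice_card_edges [Fintype V] (h : NearBipartition G P Q R) :
    2 * G.edgeFinset.card + 2 * (missing G P Q).card =
      2 * (P.card * Q.card) + 2 * (∑ u ∈ R, (degIn G P u + degIn G Q u))
        + ∑ u ∈ R, degIn G R u := by
  have hP : ∑ v ∈ P, G.degree v = ∑ v ∈ P, degIn G Q v + ∑ v ∈ P, degIn G R v := by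
    rw [← Finset.sum_add_distrib]
    refine Finset.sum_congr rfl fun v hv => ?_
    rw [h.degree_eq, h.degIn_P hv, zero_add]
  have hQ : ∑ v ∈ Q, G.degree v = ∑ v ∈ Q, degIn G P v + ∑ v ∈ Q, degIn G R v := by
    rw [← Finset.sum_add_distrib]
    refine Finset.sum_congr rfl fun v hv => ?_
    rw [h.degree_eq, h.degIn_Q hv, add_zero]
  have hR : ∑ v ∈ R, G.degree v = ∑ u ∈ R, (degIn G P u + degIn G Q u) + ∑ u ∈ R, degIn G R u := by
    rw [← Finset.sum_add_distrib]
    exact Finset.sum_congr rfl fun v hv => h.degree_eq v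
  have hs := G.sum_degrees_eq_twice_card_edges
  rw [h.sum_eq, hP, hQ, hR] at hs
  have hm := sum_degIn_add_card_missing G P Q
  rw [sum_degIn_comm G P R, sum_degIn_comm G Q R, sum_degIn_comm G Q P] at hs
  rw [Finset.sum_add_distrib] at hs ⊢
  omega

end NearBipartition

namespace GrotzschCore

variable {u1 u2 u3 v13 v23 w13 w23 : V}

theorem sum_R (c : GrotzschCore G P Q R u1 u2 u3 v13 v23 w13 w23) {M : Type*} [AddCommMonoid M]
    (f : V → M) : ∑ u ∈ R, f u = f u1 + f u2 + f u3 := by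
  rw [c.eqR, Finset.sum_insert, Finset.sum_pair c.ne23, add_assoc]
  simp [c.adj12.ne, c.ne13]

theorem card_R (c : GrotzschCore G P Q R u1 u2 u3 v13 v23 w13 w23) : R.card = 3 := by
  rw [c.eqR]
  exact Finset.card_eq_three.2 ⟨u1, u2, u3, c.adj12.ne, c.ne13, c.ne23, rfl⟩

theorem sum_degIn_R (c : GrotzschCore G P Q R u1 u2 u3 v13 v23 w13 w23) :
    ∑ u ∈ R, degIn G R u = 2 := by
  rw [c.sum_R]
  simp only [degIn, Finset.card_filter, c.sum_R]
  have h1 := c.adj12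
  have h2 := c.adj12.symm
  have h3 := c.nadj13
  have h4 := c.nadj23
  have h5 : ¬ G.Adj u3 u1 := fun h => h3 h.symm
  have h6 : ¬ G.Adj u3 u2 := fun h => h4 h.symm
  simp [h1, h2, h3, h4, h5, h6]

theorem card_edges [Fintype V] (c : GrotzschCore G P Q R u1 u2 u3 v13 v23 w13 w23)
    (h : NearBipartition G P Q R) :
    G.edgeFinset.card + (missing G P Q).card =
      P.card * Q.card + ∑ u ∈ R, (degIn G P u + degIn G Q u) + 1 := by
  have h1 := h.twice_card_edges
  rw [c.sum_degIn_R] at h1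
  omega

/-- Edges at R are paid for by missing pairs: w13 misses every P-neighbour of u1 or u3, w23 every
P-neighbour of u2 or u3, and v13, v23 behave likewise in Q. The four pairs {v13, v23} × {w13, w23}
would be counted twice, whence the 4. -/
theorem sum_degIn_le (c : GrotzschCore G P Q R u1 u2 u3 v13 v23 w13 w23) (hG : G.CliqueFree 3) :
    ∑ u ∈ R, (degIn G P u + degIn G Q u) ≤ (missing G P Q).card + 4 := by
  set P1 := P.filter (G.Adj u1) with hP1
  set P2 := P.filter (G.Adj u2) with hP2
  set P3 := P.filter (G.Adj u3) with hP3
  set Q1 := Q.filter (G.Adj u1) with hQ1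
  set Q2 := Q.filter (G.Adj u2) with hQ2
  set Q3 := Q.filter (G.Adj u3) with hQ3
  have nw := c.ne_w hG
  have nv := c.ne_v hG
  have dP : Disjoint P1 P2 := by
    rw [Finset.disjoint_left]
    intro x h1 h2
    rw [hP1, mem_filter] at h1
    rw [hP2, mem_filter] at h2
    exact not_adj_of_common hG c.adj12 h1.2 h2.2
  have dQ : Disjoint Q1 Q2 := by
    rw [Finset.disjoint_left]
    intro x h1 h2
    rw [hQ1, mem_filter] at h1
    rw [hQ2, mem_filter] at h2
    exact not_adj_of_common hG c.adj12 h1.2 h2.2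
  -- Inclusion–exclusion; it applies because the neighbourhoods of u1 and u2 are disjoint.
  have sub : ∀ {A B C : Finset V}, Disjoint B C →
      B.card + C.card + A.card ≤ (A ∪ B).card + (A ∪ C).card := by
    intro A B C hBC
    rw [← Finset.card_union_of_disjoint hBC, ← Finset.card_union_add_card_inter (A ∪ B)]
    exact Nat.add_le_add (Finset.card_le_card (by grind)) (Finset.card_le_card (by grind))
  have sP := sub (A := P3) dP
  have sQ := sub (A := Q3) dQ
  set W : Finset V := {w13, w23} with hW
  have cW : W.card = 2 := Finset.card_pair nw
  have hWQ : W ⊆ Q3 := by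
    intro y hy
    rw [hW, mem_insert, mem_singleton] at hy
    rw [hQ3, mem_filter]
    rcases hy with rfl | rfl
    · exact ⟨c.w13Q, c.aw13_3⟩
    · exact ⟨c.w23Q, c.aw23_3⟩
  have cs : ∀ A : Finset V, (Q3 ∪ A).card ≤ ((Q3 ∪ A) \ W).card + 2 := fun A => by
    rw [← cW, Finset.card_sdiff_add_card_eq_card (hWQ.trans Finset.subset_union_left)]
  set T1 := (P3 ∪ P1) ×ˢ ({w13} : Finset V) with hT1
  set T2 := (P3 ∪ P2) ×ˢ ({w23} : Finset V) with hT2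
  set T3 := ({v13} : Finset V) ×ˢ ((Q3 ∪ Q1) \ W) with hT3
  set T4 := ({v23} : Finset V) ×ˢ ((Q3 ∪ Q2) \ W) with hT4
  have hsub : (T1 ∪ T2) ∪ (T3 ∪ T4) ⊆ missing G P Q := by
    have k1 : ∀ {x y : V}, G.Adj u1 x → G.Adj u1 y → ¬ G.Adj x y := fun a b =>
      not_adj_of_common hG a b
    have k2 : ∀ {x y : V}, G.Adj u2 x → G.Adj u2 y → ¬ G.Adj x y := fun a b =>
      not_adj_of_common hG a b
    have k3 : ∀ {x y : V}, G.Adj u3 x → G.Adj u3 y → ¬ G.Adj x y := fun a b =>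
      not_adj_of_common hG a b
    obtain ⟨_, _, _, _, _, _, a1, a2, a3, a4, a5, a6, a7, a8, a9, a10, a11, a12⟩ := c
    rintro ⟨x, y⟩ he
    rw [mem_missing]
    simp only [hT1, hT2, hT3, hT4, mem_union, mem_product, mem_singleton, mem_sdiff, hP1, hP2,
      hP3, hQ1, hQ2, hQ3, mem_filter] at he
    rcases he with (⟨h | h, rfl⟩ | ⟨h | h, rfl⟩) | (⟨rfl, h | h, _⟩ | ⟨rfl, h | h, _⟩)
    · exact ⟨⟨h.1, a3⟩, k3 h.2 a10⟩
    · exact ⟨⟨h.1, a3⟩, k1 h.2 a9⟩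
    · exact ⟨⟨h.1, a4⟩, k3 h.2 a12⟩
    · exact ⟨⟨h.1, a4⟩, k2 h.2 a11⟩
    · exact ⟨⟨a1, h.1⟩, k3 a6 h.2⟩
    · exact ⟨⟨a1, h.1⟩, k1 a5 h.2⟩
    · exact ⟨⟨a2, h.1⟩, k3 a8 h.2⟩
    · exact ⟨⟨a2, h.1⟩, k2 a7 h.2⟩
  have d12 : Disjoint T1 T2 := Finset.disjoint_product.2 (Or.inr (by simpa using nw))
  have d34 : Disjoint T3 T4 := Finset.disjoint_product.2 (Or.inl (by simpa using nv))
  have dd : Disjoint (T1 ∪ T2) (T3 ∪ T4) := by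
    simp only [Finset.disjoint_union_left, Finset.disjoint_union_right, hT1, hT2, hT3, hT4,
      Finset.disjoint_product, Finset.disjoint_singleton_left]
    simp [hW]
  have hc := Finset.card_le_card hsub
  rw [Finset.card_union_of_disjoint dd, Finset.card_union_of_disjoint d12,
    Finset.card_union_of_disjoint d34, hT1, hT2, hT3, hT4] at hc
  simp only [Finset.card_product, Finset.card_singleton, mul_one, one_mul] at hc
  have c1 := cs Q1
  have c2 := cs Q2
  rw [c.sum_R]
  simp only [degIn, ← hP1, ← hP2, ← hP3, ← hQ1, ← hQ2, ← hQ3]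
  omega

theorem card_edges_le [Fintype V] (c : GrotzschCore G P Q R u1 u2 u3 v13 v23 w13 w23)
    (h : NearBipartition G P Q R) (hG : G.CliqueFree 3) :
    G.edgeFinset.card ≤ P.card * Q.card + 5 := by
  have h1 := c.card_edges h
  have h2 := c.sum_degIn_le hG
  omega

end GrotzschCore

end Counting

/-! ### Adjacency in the Grötzsch graph, by sides. -/

theorem grotzsch_adj_iff (i j : GrotzschVertex) :
    grotzsch.Adj i j ↔ s(i, j) ∈ grotzschEdges ∧ i ≠ j := by
  simp [grotzsch]

/-- The side of a vertex of the Grötzsch graph: `0` for the neighbours of `y`, `1` for the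
neighbours of `x` and `y`, `2` for the three remaining vertices. -/
def grotzschSide : GrotzschVertex → Fin 3
  | .v13 | .v23 | .v1 | .v2 | .x => 0
  | .w13 | .w23 | .y => 1
  | .u1 | .u2 | .u3 => 2

theorem grotzsch_adj_zero_zero (i j : GrotzschVertex) (hi : grotzschSide i = 0)
    (hj : grotzschSide j = 0) : ¬ grotzsch.Adj i j := by
  rw [grotzsch_adj_iff]
  revert i j
  decide

theorem grotzsch_adj_one_one (i j : GrotzschVertex) (hi : grotzschSide i = 1)
    (hj : grotzschSide j = 1) : ¬ grotzsch.Adj i j := by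
  rw [grotzsch_adj_iff]
  revert i j
  decide

theorem grotzsch_adj_zero_one (i j : GrotzschVertex) (hi : grotzschSide i = 0)
    (hj : grotzschSide j = 1) : grotzsch.Adj i j ↔
      ¬ (i = .v13 ∧ j = .w13 ∨ i = .v13 ∧ j = .w23 ∨ i = .v23 ∧ j = .w13 ∨ i = .v23 ∧ j = .w23 ∨
        i = .v1 ∧ j = .w13 ∨ i = .v2 ∧ j = .w23) := by
  rw [grotzsch_adj_iff]
  revert i j
  decide

theorem grotzsch_adj_two_zero (i j : GrotzschVertex) (hi : grotzschSide i = 2)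
    (hj : grotzschSide j = 0) : grotzsch.Adj i j ↔
      (i = .u1 ∧ (j = .v13 ∨ j = .v1) ∨ i = .u2 ∧ (j = .v23 ∨ j = .v2) ∨
        i = .u3 ∧ (j = .v13 ∨ j = .v23)) := by
  rw [grotzsch_adj_iff]
  revert i j
  decide

theorem grotzsch_adj_two_one (i j : GrotzschVertex) (hi : grotzschSide i = 2)
    (hj : grotzschSide j = 1) : grotzsch.Adj i j ↔
      (i = .u1 ∧ j = .w13 ∨ i = .u2 ∧ j = .w23 ∨ i = .u3 ∧ (j = .w13 ∨ j = .w23)) := by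
  rw [grotzsch_adj_iff]
  revert i j
  decide

theorem grotzsch_adj_two_two (i j : GrotzschVertex) (hi : grotzschSide i = 2)
    (hj : grotzschSide j = 2) : grotzsch.Adj i j ↔ (i = .u1 ∧ j = .u2 ∨ i = .u2 ∧ j = .u1) := by
  rw [grotzsch_adj_iff]
  revert i j
  decide

/-! ### At least six missing pairs, and the case of equality. -/

section BlowUpIso
open Finset
open scoped Classical

variable {V : Type*}

/-- A graph with a homomorphism-like colouring by `H` whose classes have sizes `m` is the blow-up
of `H` by `m`. -/
theorem nonempty_iso_blowUp {W : Type*} [DecidableEq W] [Fintype V] {G : SimpleGraph V} {H : SimpleGraph W}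
    {m : W → ℕ} (f : V → W) (hadj : ∀ a b, G.Adj a b ↔ H.Adj (f a) (f b))
    (hcard : ∀ w, (univ.filter fun a => f a = w).card = m w) : Nonempty (G ≃g blowUp H m) := by
  have e : ∀ w, {a // f a = w} ≃ Fin (m w) := fun w =>
    Fintype.equivFinOfCardEq (by rw [Fintype.card_subtype, hcard])
  refine ⟨⟨(Equiv.sigmaFiberEquiv f).symm.trans (Equiv.sigmaCongrRight e), ?_⟩⟩
  intro a b
  rw [hadj]
  rfl

variable {G : SimpleGraph V} {P Q R : Finset V}

theorem exists_grotzsch_labelling {u1 u2 u3 v13 v23 w13 w23 x1 x2 : V}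
    (h : NearBipartition G P Q R) (hR : R = {u1, u2, u3}) (n12 : u1 ≠ u2) (n13 : u1 ≠ u3)
    (n23 : u2 ≠ u3) (hv13 : v13 ∈ P) (hv23 : v23 ∈ P) (hx1 : x1 ∈ P) (hx2 : x2 ∈ P)
    (e1 : v13 ≠ v23) (e2 : v13 ≠ x1) (e3 : v13 ≠ x2) (e4 : v23 ≠ x1) (e5 : v23 ≠ x2)
    (e6 : x1 ≠ x2) (hw13 : w13 ∈ Q) (hw23 : w23 ∈ Q) (e7 : w13 ≠ w23) :
    ∃ f : V → GrotzschVertex, (∀ a, f a = .v13 ↔ a = v13) ∧ (∀ a, f a = .v23 ↔ a = v23) ∧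
      (∀ a, f a = .v1 ↔ a = x1) ∧ (∀ a, f a = .v2 ↔ a = x2) ∧ (∀ a, f a = .u1 ↔ a = u1) ∧
      (∀ a, f a = .u2 ↔ a = u2) ∧ (∀ a, f a = .u3 ↔ a = u3) ∧ (∀ a, f a = .w13 ↔ a = w13) ∧
      (∀ a, f a = .w23 ↔ a = w23) ∧
      (∀ a, f a = .x ↔ a ∈ P ∧ a ≠ v13 ∧ a ≠ v23 ∧ a ≠ x1 ∧ a ≠ x2) ∧
      (∀ a, f a = .y ↔ a ∈ Q ∧ a ≠ w13 ∧ a ≠ w23) := by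
  have hmem : ∀ v, v ∈ R ↔ v = u1 ∨ v = u2 ∨ v = u3 := fun v => by rw [hR]; simp
  have d1 : ∀ v, v ∈ P → v ∉ Q := fun v hv => (h.notMem_of_memP hv).1
  have d2 : ∀ v, v ∈ P → v ∉ R := fun v hv => (h.notMem_of_memP hv).2
  have d3 : ∀ v, v ∈ Q → v ∉ R := fun v hv => (h.notMem_of_memQ hv).2
  have d4 := h.cover
  clear h hR
  refine ⟨fun a => if a ∈ R then (if a = u1 then .u1 else if a = u2 then .u2 else .u3) else
    if a ∈ P then (if a = v13 then .v13 else if a = v23 then .v23 else if a = x1 then .v1 else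
      if a = x2 then .v2 else .x) else
      (if a = w13 then .w13 else if a = w23 then .w23 else .y), ?_, ?_, ?_, ?_, ?_, ?_, ?_, ?_, ?_,
        ?_, ?_⟩ <;> intro a <;> beta_reduce <;> grind

namespace GrotzschCore

variable {u1 u2 u3 v13 v23 w13 w23 : V}

/-- If the extra neighbours x and y lie on opposite sides, they belong to the same u1, so xy is
itself missing. This seventh pair rules the mixed case out of the extremal analysis. -/
theorem seven_le_card_missing (c : GrotzschCore G P Q R u1 u2 u3 v13 v23 w13 w23)
    (hG : G.CliqueFree 3) {x y : V} (hx : x ∈ P) (hx1 : G.Adj u1 x) (hx3 : ¬ G.Adj u3 x)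
    (hy : y ∈ Q) (hy1 : G.Adj u1 y) (hy3 : ¬ G.Adj u3 y) : 7 ≤ (missing G P Q).card := by
  have nw := c.ne_w hG
  have nv := c.ne_v hG
  have k1 : ∀ {x y : V}, G.Adj u1 x → G.Adj u1 y → ¬ G.Adj x y := fun a b =>
    not_adj_of_common hG a b
  have k3 : ∀ {x y : V}, G.Adj u3 x → G.Adj u3 y → ¬ G.Adj x y := fun a b =>
    not_adj_of_common hG a b
  obtain ⟨_, _, _, _, _, _, a1, a2, a3, a4, a5, a6, a7, a8, a9, a10, a11, a12⟩ := c
  have hsub : ({(v13, w13), (v13, w23), (v23, w13), (v23, w23), (x, w13), (v13, y), (x, y)} :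
      Finset (V × V)) ⊆ missing G P Q := by
    intro e he
    rw [mem_missing]
    simp only [mem_insert, mem_singleton] at he
    rcases he with rfl | rfl | rfl | rfl | rfl | rfl | rfl
    · exact ⟨⟨a1, a3⟩, k3 a6 a10⟩
    · exact ⟨⟨a1, a4⟩, k3 a6 a12⟩
    · exact ⟨⟨a2, a3⟩, k3 a8 a10⟩
    · exact ⟨⟨a2, a4⟩, k3 a8 a12⟩
    · exact ⟨⟨hx, a3⟩, k1 hx1 a9⟩
    · exact ⟨⟨a1, hy⟩, k1 a5 hy1⟩
    · exact ⟨⟨hx, hy⟩, k1 hx1 hy1⟩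
  refine le_trans (le_of_eq ?_) (Finset.card_le_card hsub)
  have e1 : v13 ≠ x := fun h => hx3 (h ▸ a6)
  have e2 : v23 ≠ x := fun h => hx3 (h ▸ a8)
  have e3 : w13 ≠ y := fun h => hy3 (h ▸ a10)
  have e4 : w23 ≠ y := fun h => hy3 (h ▸ a12)
  simp [Finset.card_insert_of_notMem, nw, nv, e1, e2, e3, e4, e1.symm]

/-- Four pairs come from common neighbours of u3, one each from x1 and x2. If there are no others,
every neighbour of R is determined, since a further one would be missed by one of w13, w23, v13,
v23. The vertices x1, x2 become v1, v2 of the Grötzsch graph. -/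
theorem six_le_card_missing_and_iso [Fintype V]
    (c : GrotzschCore G P Q R u1 u2 u3 v13 v23 w13 w23) (h : NearBipartition G P Q R)
    (hG : G.CliqueFree 3) {x1 x2 : V} (hx1 : x1 ∈ P) (h11 : G.Adj u1 x1) (h13 : ¬ G.Adj u3 x1)
    (hx2 : x2 ∈ P) (h22 : G.Adj u2 x2) (h23 : ¬ G.Adj u3 x2) :
    6 ≤ (missing G P Q).card ∧
      ((missing G P Q).card = 6 → Nonempty (G ≃g F1 (P.card - 4) (Q.card - 2))) := by
  have nw := c.ne_w hG
  have nv := c.ne_v hG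
  have k1 : ∀ {x y : V}, G.Adj u1 x → G.Adj u1 y → ¬ G.Adj x y := fun a b =>
    not_adj_of_common hG a b
  have k2 : ∀ {x y : V}, G.Adj u2 x → G.Adj u2 y → ¬ G.Adj x y := fun a b =>
    not_adj_of_common hG a b
  have k3 : ∀ {x y : V}, G.Adj u3 x → G.Adj u3 y → ¬ G.Adj x y := fun a b =>
    not_adj_of_common hG a b
  have k12 : ∀ {x : V}, G.Adj u1 x → ¬ G.Adj u2 x := fun a => not_adj_of_common hG c.adj12 a
  obtain ⟨eqR, ne13, ne23, adj12, nadj13, nadj23, a1, a2, a3, a4, a5, a6, a7, a8, a9, a10, a11,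
    a12⟩ := c
  set S : Finset (V × V) :=
    {(v13, w13), (v13, w23), (v23, w13), (v23, w23), (x1, w13), (x2, w23)} with hS
  have hsub : S ⊆ missing G P Q := by
    intro e he
    rw [mem_missing]
    simp only [hS, mem_insert, mem_singleton] at he
    rcases he with rfl | rfl | rfl | rfl | rfl | rfl
    · exact ⟨⟨a1, a3⟩, k3 a6 a10⟩
    · exact ⟨⟨a1, a4⟩, k3 a6 a12⟩
    · exact ⟨⟨a2, a3⟩, k3 a8 a10⟩
    · exact ⟨⟨a2, a4⟩, k3 a8 a12⟩
    · exact ⟨⟨hx1, a3⟩, k1 h11 a9⟩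
    · exact ⟨⟨hx2, a4⟩, k2 h22 a11⟩
  have e1 : v13 ≠ x1 := fun h => h13 (h ▸ a6)
  have e2 : v23 ≠ x1 := fun h => h13 (h ▸ a8)
  have e3 : v13 ≠ x2 := fun h => h23 (h ▸ a6)
  have e4 : v23 ≠ x2 := fun h => h23 (h ▸ a8)
  have e5 : x1 ≠ x2 := fun h => k12 h11 (h ▸ h22)
  have hcS : S.card = 6 := by
    simp [hS, Finset.card_insert_of_notMem, nw, nv, e1, e2, e3, e4, e5]
  refine ⟨hcS ▸ Finset.card_le_card hsub, fun hc6 => ?_⟩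
  have hM : S = missing G P Q := Finset.eq_of_subset_of_card_le hsub (by rw [hc6, hcS])
  have hmis : ∀ x ∈ P, ∀ y ∈ Q, (¬ G.Adj x y ↔ (x, y) ∈ S) := by
    intro x hx y hy
    rw [hM, mem_missing]
    simp [hx, hy]
  simp only [hS, mem_insert, mem_singleton, Prod.mk.injEq] at hmis
  have hR : ∀ v, v ∈ R ↔ v = u1 ∨ v = u2 ∨ v = u3 := fun v => by rw [eqR]; simp
  have n12 := adj12.ne
  -- the neighbours of the three exceptional vertices
  have hu1P : ∀ x ∈ P, (G.Adj u1 x ↔ x = v13 ∨ x = x1) := by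
    intro x hx
    constructor
    · intro hux
      have m := (hmis x hx w13 a3).1 (k1 hux a9)
      have : x ≠ v23 := fun h => k12 hux (h ▸ a7)
      grind
    · rintro (rfl | rfl) <;> assumption
  have hu2P : ∀ x ∈ P, (G.Adj u2 x ↔ x = v23 ∨ x = x2) := by
    intro x hx
    constructor
    · intro hux
      have m := (hmis x hx w23 a4).1 (k2 hux a11)
      have : x ≠ v13 := fun h => k12 (h ▸ a5) hux
      grind
    · rintro (rfl | rfl) <;> assumption
  have hu3P : ∀ x ∈ P, (G.Adj u3 x ↔ x = v13 ∨ x = v23) := by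
    intro x hx
    constructor
    · intro hux
      have m := (hmis x hx w13 a3).1 (k3 hux a10)
      have : x ≠ x1 := fun h => h13 (h ▸ hux)
      grind
    · rintro (rfl | rfl) <;> assumption
  have hu1Q : ∀ y ∈ Q, (G.Adj u1 y ↔ y = w13) := by
    intro y hy
    constructor
    · intro huy
      have m := (hmis v13 a1 y hy).1 (k1 a5 huy)
      have : y ≠ w23 := fun h => k12 huy (h ▸ a11)
      grind
    · rintro rfl
      assumption
  have hu2Q : ∀ y ∈ Q, (G.Adj u2 y ↔ y = w23) := by
    intro y hy
    constructor
    · intro huy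
      have m := (hmis v23 a2 y hy).1 (k2 a7 huy)
      have : y ≠ w13 := fun h => k12 (h ▸ a9) huy
      grind
    · rintro rfl
      assumption
  have hu3Q : ∀ y ∈ Q, (G.Adj u3 y ↔ y = w13 ∨ y = w23) := by
    intro y hy
    constructor
    · intro huy
      have m := (hmis v13 a1 y hy).1 (k3 a6 huy)
      grind
    · rintro (rfl | rfl) <;> assumption
  obtain ⟨f, fv13, fv23, fv1, fv2, fu1, fu2, fu3, fw13, fw23, fx, fy⟩ :=
    exists_grotzsch_labelling h eqR n12 ne13 ne23 a1 a2 hx1 hx2 nv e1 e3 e2 e4 e5 a3 a4 nw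
  have sP : ∀ a ∈ P, grotzschSide (f a) = 0 := by
    intro a ha
    by_cases h1 : a = v13
    · rw [(fv13 a).2 h1]; rfl
    by_cases h2 : a = v23
    · rw [(fv23 a).2 h2]; rfl
    by_cases h3 : a = x1
    · rw [(fv1 a).2 h3]; rfl
    by_cases h4 : a = x2
    · rw [(fv2 a).2 h4]; rfl
    rw [(fx a).2 ⟨ha, h1, h2, h3, h4⟩]; rfl
  have sQ : ∀ a ∈ Q, grotzschSide (f a) = 1 := by
    intro a ha
    by_cases h1 : a = w13
    · rw [(fw13 a).2 h1]; rfl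
    by_cases h2 : a = w23
    · rw [(fw23 a).2 h2]; rfl
    rw [(fy a).2 ⟨ha, h1, h2⟩]; rfl
  have sR : ∀ a ∈ R, grotzschSide (f a) = 2 := by
    intro a ha
    rcases (hR a).1 ha with h1 | h1 | h1
    · rw [(fu1 a).2 h1]; rfl
    · rw [(fu2 a).2 h1]; rfl
    · rw [(fu3 a).2 h1]; rfl
  -- One order of each pair of sides suffices; the others follow by symmetry of adjacency.
  have key : ∀ a b, (a ∈ P ∧ b ∈ P) ∨ (a ∈ P ∧ b ∈ Q) ∨ (a ∈ Q ∧ b ∈ Q) ∨ (a ∈ R ∧ b ∈ P) ∨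
      (a ∈ R ∧ b ∈ Q) ∨ (a ∈ R ∧ b ∈ R) → (G.Adj a b ↔ grotzsch.Adj (f a) (f b)) := by
    rintro a b (⟨ha, hb⟩ | ⟨ha, hb⟩ | ⟨ha, hb⟩ | ⟨ha, hb⟩ | ⟨ha, hb⟩ | ⟨ha, hb⟩)
    · exact iff_of_false (h.indepP a ha b hb) (grotzsch_adj_zero_zero _ _ (sP a ha) (sP b hb))
    · rw [grotzsch_adj_zero_one _ _ (sP a ha) (sQ b hb), ← not_iff_not, hmis a ha b hb]
      simp only [fv13, fv23, fv1, fv2, fw13, fw23, not_not]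
    · exact iff_of_false (h.indepQ a ha b hb) (grotzsch_adj_one_one _ _ (sQ a ha) (sQ b hb))
    · rw [grotzsch_adj_two_zero _ _ (sR a ha) (sP b hb)]
      simp only [fv13, fv23, fv1, fv2, fu1, fu2, fu3]
      rcases (hR a).1 ha with rfl | rfl | rfl
      · rw [hu1P b hb]; simp [n12, ne13]
      · rw [hu2P b hb]; simp [n12.symm, ne23]
      · rw [hu3P b hb]; simp [ne23.symm, ne13.symm]
    · rw [grotzsch_adj_two_one _ _ (sR a ha) (sQ b hb)]
      simp only [fw13, fw23, fu1, fu2, fu3]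
      rcases (hR a).1 ha with rfl | rfl | rfl
      · rw [hu1Q b hb]; simp [n12, ne13]
      · rw [hu2Q b hb]; simp [n12.symm, ne23]
      · rw [hu3Q b hb]; simp [ne23.symm, ne13.symm]
    · rw [grotzsch_adj_two_two _ _ (sR a ha) (sR b hb)]
      simp only [fu1, fu2]
      have m1 := adj12.symm
      have m2 : ¬ G.Adj u3 u1 := fun h => nadj13 h.symm
      have m3 : ¬ G.Adj u3 u2 := fun h => nadj23 h.symm
      rcases (hR a).1 ha with rfl | rfl | rfl <;> rcases (hR b).1 hb with rfl | rfl | rfl <;>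
        simp [*, n12.symm, ne13.symm, ne23.symm]
  refine nonempty_iso_blowUp f ?_ ?_
  · intro a b
    have ka := key a b
    have kb := key b a
    rw [G.adj_comm b a, grotzsch.adj_comm (f b) (f a)] at kb
    rcases h.cover a with ha | ha | ha <;> rcases h.cover b with hb | hb | hb <;>
      simp only [ha, hb, and_self, true_or, or_true, true_implies] at ka kb <;> first | exact ka | exact kb
  · have single : ∀ (k : GrotzschVertex) (v : V), (∀ a, f a = k ↔ a = v) →
        (univ.filter fun a => f a = k).card = 1 := by
      intro k v hk
      rw [Finset.card_eq_one]
      exact ⟨v, by ext a; simp [hk]⟩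
    intro k
    cases k
    · exact single _ _ fv13
    · exact single _ _ fv23
    · exact single _ _ fv1
    · exact single _ _ fv2
    · have hs : (univ.filter fun a => f a = .x) = P \ {v13, v23, x1, x2} := by
        ext a
        simp [fx]
      have hsP : ({v13, v23, x1, x2} : Finset V) ⊆ P := by
        intro a ha
        simp only [mem_insert, mem_singleton] at ha
        rcases ha with rfl | rfl | rfl | rfl <;> assumption
      rw [hs, Finset.card_sdiff_of_subset hsP]
      simp [Finset.card_insert_of_notMem, nv, e1, e2, e3, e4, e5, F1Size]
    · exact single _ _ fu1
    · exact single _ _ fu2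
    · exact single _ _ fu3
    · exact single _ _ fw13
    · exact single _ _ fw23
    · have hs : (univ.filter fun a => f a = .y) = Q \ {w13, w23} := by
        ext a
        simp [fy]
      have hsQ : ({w13, w23} : Finset V) ⊆ Q := by
        intro a ha
        simp only [mem_insert, mem_singleton] at ha
        rcases ha with rfl | rfl <;> assumption
      rw [hs, Finset.card_sdiff_of_subset hsQ]
      simp [Finset.card_insert_of_notMem, nw, F1Size]

/-- There are at least six missing pairs, and exactly six only in the graphs `F₁(s, t)`. -/
theorem card_missing [Fintype V] (c : GrotzschCore G P Q R u1 u2 u3 v13 v23 w13 w23)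
    (h : NearBipartition G P Q R) (hG : G.CliqueFree 3) (hχ : ¬ G.Colorable 3) :
    6 ≤ (missing G P Q).card ∧
      ((missing G P Q).card = 6 → Nonempty (G ≃g F1 (P.card - 4) (Q.card - 2)) ∨
        Nonempty (G ≃g F1 (Q.card - 4) (P.card - 2))) := by
  rcases c.exists_outside h hG hχ with ⟨x1, a1, a2, a3⟩ | ⟨y2, a1, a2, a3⟩ <;>
    rcases c.swap.exists_outside h hG hχ with ⟨x2, b1, b2, b3⟩ | ⟨y1, b1, b2, b3⟩
  · have := c.six_le_card_missing_and_iso h hG a1 a2 a3 b1 b2 b3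
    exact ⟨this.1, fun h6 => Or.inl (this.2 h6)⟩
  · have := c.seven_le_card_missing hG a1 a2 a3 b1 b2 b3
    exact ⟨by omega, fun h6 => by omega⟩
  · have := c.swap.seven_le_card_missing hG b1 b2 b3 a1 a2 a3
    exact ⟨by omega, fun h6 => by omega⟩
  · have := c.symm.six_le_card_missing_and_iso h.symm hG b1 b2 b3 a1 a2 a3
    rw [missing_swap G P Q] at this
    exact ⟨this.1, fun h6 => Or.inr (this.2 h6)⟩

end GrotzschCore
end BlowUpIso

/-! ### Order, triangle-freeness and chromatic number of F₁(s, t). -/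

theorem grotzsch_sum {M : Type*} [AddCommMonoid M] (f : GrotzschVertex → M) :
    ∑ v, f v = f .v13 + (f .v23 + (f .v1 + (f .v2 + (f .x + (f .u1 + (f .u2 + (f .u3 +
      (f .w13 + (f .w23 + f .y))))))))) := by
  have h : (Finset.univ : Finset GrotzschVertex) =
      {.v13, .v23, .v1, .v2, .x, .u1, .u2, .u3, .w13, .w23, .y} := rfl
  rw [h]
  repeat rw [Finset.sum_insert (by decide)]
  rw [Finset.sum_singleton]

theorem card_F1 (s t : ℕ) :
    Fintype.card (Σ v : GrotzschVertex, Fin (F1Size s t v)) = s + t + 9 := by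
  rw [Fintype.card_sigma]
  simp only [Fintype.card_fin]
  rw [grotzsch_sum]
  simp only [F1Size]
  omega

theorem grotzsch_triangle_free : ∀ i j k : GrotzschVertex, grotzsch.Adj i j → grotzsch.Adj i k →
    ¬ grotzsch.Adj j k := by
  simp only [grotzsch_adj_iff]
  decide +kernel

theorem cliqueFree_F1 (s t : ℕ) : (F1 s t).CliqueFree 3 := by
  intro S hS
  obtain ⟨a, b, c, hab, hac, hbc, -⟩ := SimpleGraph.is3Clique_iff.1 hS
  exact grotzsch_triangle_free a.1 b.1 c.1 hab hac hbc

/-- Two colours remain and must alternate along the path, so its five vertices cannot close up to a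
properly coloured cycle. -/
theorem fin_three_cycle_aux : ∀ k a b c d e : Fin 3, a ≠ k → b ≠ k → c ≠ k → d ≠ k → e ≠ k →
    a ≠ b → b ≠ c → c ≠ d → d ≠ e → e = a := by
  intro k a b c d e
  simp only [ne_eq, Fin.ext_iff]
  omega

/-- Recolouring every vertex of the 5-cycle that has the colour of `y` with the colour of its copy
would give a 2-colouring of the 5-cycle. -/
theorem grotzsch_not_colorable : ¬ grotzsch.Colorable 3 := by
  rintro ⟨C⟩
  have h : ∀ i j : GrotzschVertex, s(i, j) ∈ grotzschEdges → i ≠ j → C i ≠ C j := fun i j hij hne =>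
    C.valid ((grotzsch_adj_iff i j).2 ⟨hij, hne⟩)
  have c1 := h .u1 .u2 (by decide) (by decide)
  have c2 := h .u2 .w23 (by decide) (by decide)
  have c3 := h .w23 .u3 (by decide) (by decide)
  have c4 := h .u3 .w13 (by decide) (by decide)
  have c5 := h .w13 .u1 (by decide) (by decide)
  have d1 := h .v2 .u2 (by decide) (by decide)
  have d2 := h .v2 .w13 (by decide) (by decide)
  have d3 := h .v1 .u1 (by decide) (by decide)
  have d4 := h .v1 .w23 (by decide) (by decide)
  have d5 := h .v23 .u2 (by decide) (by decide)
  have d6 := h .v23 .u3 (by decide) (by decide)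
  have d7 := h .x .w13 (by decide) (by decide)
  have d8 := h .x .w23 (by decide) (by decide)
  have d9 := h .v13 .u1 (by decide) (by decide)
  have d10 := h .v13 .u3 (by decide) (by decide)
  have e1 := h .y .v13 (by decide) (by decide)
  have e2 := h .y .v23 (by decide) (by decide)
  have e3 := h .y .v1 (by decide) (by decide)
  have e4 := h .y .v2 (by decide) (by decide)
  have e5 := h .y .x (by decide) (by decide)
  let r : GrotzschVertex → GrotzschVertex → Fin 3 := fun i j => if C i = C .y then C j else C i
  have key := fin_three_cycle_aux (C .y) (r .u1 .v2) (r .u2 .v1) (r .w23 .v23) (r .u3 .x)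
    (r .w13 .v13)
  have : r .w13 .v13 ≠ r .u1 .v2 := by
    simp only [r]; split_ifs <;> grind
  refine this (key ?_ ?_ ?_ ?_ ?_ ?_ ?_ ?_ ?_) <;> simp only [r] <;> split_ifs <;> grind

theorem four_le_chromaticNumber_iff {V : Type*} (G : SimpleGraph V) :
    4 ≤ G.chromaticNumber ↔ ¬ G.Colorable 3 := by
  rw [← SimpleGraph.chromaticNumber_le_iff_colorable, not_le]
  constructor
  · intro h
    exact lt_of_lt_of_le (by norm_num) h
  · intro h
    have := Order.add_one_le_of_lt h
    norm_num at this
    exact this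

theorem triangleFreeChiGeFour_F1 {s t : ℕ} (hs : 0 < s) (ht : 0 < t) :
    TriangleFreeChiGeFour (F1 s t) := by
  refine ⟨cliqueFree_F1 s t, (four_le_chromaticNumber_iff _).2 ?_⟩
  rintro ⟨C⟩
  have hpos : ∀ v, 0 < F1Size s t v := by
    intro v
    cases v <;> simp [F1Size, hs, ht]
  exact grotzsch_not_colorable ⟨SimpleGraph.Coloring.mk (fun v => C ⟨v, ⟨0, hpos v⟩⟩)
    fun {v w} hvw => C.valid (show grotzsch.Adj v w from hvw)⟩

/-! ### Quadratic form, size and index of F₁(s, t). -/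

section BlowUpSums
open Finset
open scoped Classical

theorem blowUp_sum_neighborFinset {W : Type*} [Fintype W] (H : SimpleGraph W) (m : W → ℕ)
    (f : (Σ w, Fin (m w)) → ℝ) (a : Σ w, Fin (m w)) :
    ∑ b ∈ (blowUp H m).neighborFinset a, f b =
      ∑ w ∈ H.neighborFinset a.1, ∑ i, f ⟨w, i⟩ := by
  rw [sum_neighborFinset_eq_sum_ite, sum_neighborFinset_eq_sum_ite, Fintype.sum_sigma]
  refine Finset.sum_congr rfl fun w _ => ?_
  have hiff : ∀ i, (blowUp H m).Adj a ⟨w, i⟩ ↔ H.Adj a.1 w := fun i => Iff.rfl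
  by_cases h : H.Adj a.1 w <;> simp [hiff, h]

theorem grotzsch_sum_neighbors (f : GrotzschVertex → ℝ) :
    ∑ w ∈ grotzsch.neighborFinset .v13, f w = f .u1 + f .u3 + f .y ∧
    ∑ w ∈ grotzsch.neighborFinset .v23, f w = f .u2 + f .u3 + f .y ∧
    ∑ w ∈ grotzsch.neighborFinset .v1, f w = f .u1 + f .w23 + f .y ∧
    ∑ w ∈ grotzsch.neighborFinset .v2, f w = f .u2 + f .w13 + f .y ∧
    ∑ w ∈ grotzsch.neighborFinset .x, f w = f .w13 + f .w23 + f .y ∧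
    ∑ w ∈ grotzsch.neighborFinset .u1, f w = f .u2 + f .w13 + f .v1 + f .v13 ∧
    ∑ w ∈ grotzsch.neighborFinset .u2, f w = f .u1 + f .w23 + f .v2 + f .v23 ∧
    ∑ w ∈ grotzsch.neighborFinset .u3, f w = f .w13 + f .w23 + f .v13 + f .v23 ∧
    ∑ w ∈ grotzsch.neighborFinset .w13, f w = f .u1 + f .u3 + f .v2 + f .x ∧
    ∑ w ∈ grotzsch.neighborFinset .w23, f w = f .u2 + f .u3 + f .v1 + f .x ∧
    ∑ w ∈ grotzsch.neighborFinset .y, f w = f .v13 + f .v23 + f .v1 + f .v2 + f .x := by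
  simp only [sum_neighborFinset_eq_sum_ite, grotzsch_sum, grotzsch_adj_iff, grotzschEdges]
  refine ⟨?_, ?_, ?_, ?_, ?_, ?_, ?_, ?_, ?_, ?_, ?_⟩ <;> simp <;> ring

theorem adjForm_F1 (s t : ℕ) (f : GrotzschVertex → ℝ) :
    adjForm (F1 s t) (fun a => f a.1) =
      2 * (f .u1 * f .u2 + f .u2 * f .w23 + f .w23 * f .u3 + f .u3 * f .w13 + f .w13 * f .u1 +
        f .v2 * (f .u2 + f .w13) + f .v1 * (f .u1 + f .w23) + f .v23 * (f .u2 + f .u3) +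
        s * f .x * (f .w13 + f .w23) + f .v13 * (f .u1 + f .u3) +
        t * f .y * (f .v13 + f .v23 + f .v1 + f .v2 + s * f .x)) := by
  have hn := fun a => blowUp_sum_neighborFinset grotzsch (F1Size s t) (fun a => f a.1) a
  simp only [sum_const, card_univ, Fintype.card_fin, nsmul_eq_mul] at hn
  obtain ⟨h1, h2, h3, h4, h5, h6, h7, h8, h9, h10, h11⟩ :=
    grotzsch_sum_neighbors (fun w => (F1Size s t w : ℝ) * f w)
  unfold adjForm F1
  simp only [← Finset.mul_sum, hn]
  rw [Fintype.sum_sigma, grotzsch_sum]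
  simp only [h1, h2, h3, h4, h5, h6, h7, h8, h9, h10, h11]
  simp only [sum_const, card_univ, Fintype.card_fin, nsmul_eq_mul]
  simp only [F1Size, Nat.cast_one]
  ring

theorem sum_sq_F1 (s t : ℕ) (f : GrotzschVertex → ℝ) :
    ∑ a : Σ v, Fin (F1Size s t v), f a.1 ^ 2 = f .v13 ^ 2 + f .v23 ^ 2 + f .v1 ^ 2 + f .v2 ^ 2 +
      s * f .x ^ 2 + f .u1 ^ 2 + f .u2 ^ 2 + f .u3 ^ 2 + f .w13 ^ 2 + f .w23 ^ 2 + t * f .y ^ 2 := by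
  rw [Fintype.sum_sigma]
  simp only [sum_const, card_univ, Fintype.card_fin, nsmul_eq_mul]
  rw [grotzsch_sum]
  simp only [F1Size, Nat.cast_one]
  ring

theorem card_edgeFinset_F1 (s t : ℕ) :
    (F1 s t).edgeFinset.card = (s + 4) * (t + 2) + 5 := by
  have h := (F1 s t).sum_degrees_eq_twice_card_edges
  have h2 : ((∑ v, (F1 s t).degree v : ℕ) : ℝ) = adjForm (F1 s t) (fun _ => 1) := by
    simp [adjForm]
  rw [h, adjForm_F1 s t (fun _ => 1)] at h2
  have h3 : ((2 * (F1 s t).edgeFinset.card : ℕ) : ℝ) = ((2 * ((s + 4) * (t + 2) + 5) : ℕ) : ℝ) := by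
    rw [h2]
    push_cast
    ring
  have := Nat.cast_injective h3
  omega

/-- The spectral radius of `F₁(s, t)` is at least `√(pq) - 6 / √(pq)`, with `p = s + 4`,
`q = t + 2`. -/
theorem graphIndex_F1_sq_ge {s t : ℕ} :
    ((s : ℝ) + 4) * (t + 2) - 12 ≤ graphIndex (F1 s t) ^ 2 := by
  have : Nonempty (Σ v : GrotzschVertex, Fin (F1Size s t v)) := ⟨⟨.u1, (⟨0, Nat.one_pos⟩ : Fin 1)⟩⟩
  obtain ⟨h0, -, -, hmax⟩ := graphIndex_spec (F1 s t)
  set p : ℝ := (s : ℝ) + 4 with hp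
  set q : ℝ := (t : ℝ) + 2 with hq
  have hp0 : 0 < p := by positivity
  have hq0 : 0 < q := by positivity
  set a := Real.sqrt p with ha
  set b := Real.sqrt q with hb
  have ha2 : a ^ 2 = p := Real.sq_sqrt hp0.le
  have hb2 : b ^ 2 = q := Real.sq_sqrt hq0.le
  have ha0 : 0 < a := Real.sqrt_pos.2 hp0
  have hb0 : 0 < b := Real.sqrt_pos.2 hq0
  -- The Perron vector of the complete bipartite graph K_{p,q}, extended by 0 to u1, u2, u3; the six
  -- missing pairs are the only loss.
  let f : GrotzschVertex → ℝ := fun v => match v with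
    | .v13 | .v23 | .v1 | .v2 | .x => b
    | .w13 | .w23 | .y => a
    | .u1 | .u2 | .u3 => 0
  have h := hmax (fun v => f v.1)
  rw [adjForm_F1, sum_sq_F1] at h
  simp only [f] at h
  have h1 : 2 * (a * b) * (p * q - 6) ≤ graphIndex (F1 s t) * (2 * (p * q)) := by
    have hs : (s : ℝ) = p - 4 := by rw [hp]; ring
    have ht : (t : ℝ) = q - 2 := by rw [hq]; ring
    rw [hs, ht, ha2, hb2] at h
    linarith [h]
  have h2 : p * q - 6 ≤ graphIndex (F1 s t) * (a * b) := by
    have : p * q = (a * b) * (a * b) := by rw [← ha2, ← hb2]; ring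
    have hab : 0 < 2 * (a * b) := by positivity
    refine le_of_mul_le_mul_left ?_ hab
    calc _ ≤ _ := h1
      _ = _ := by rw [this]; ring
  -- Thus ρ² ≥ 2ρ√(pq) - pq ≥ 2(pq - 6) - pq.
  have h3 : 0 ≤ (graphIndex (F1 s t) - a * b) ^ 2 := sq_nonneg _
  have h4 : (a * b) ^ 2 = p * q := by rw [mul_pow, ha2, hb2]
  nlinarith

end BlowUpSums

/-! ### Near-bipartitions of dense triangle-free graphs, and the edge bound. -/

section Structure
open Finset
open scoped Classical

variable {V : Type*} {G : SimpleGraph V}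

theorem NearBipartition.of_disjoint [Fintype V] {P Q : Finset V} (hP : ∀ x ∈ P, ∀ y ∈ P, ¬ G.Adj x y)
    (hQ : ∀ x ∈ Q, ∀ y ∈ Q, ¬ G.Adj x y) (hd : Disjoint P Q) :
    NearBipartition G P Q (univ \ (P ∪ Q)) where
  indepP := hP
  indepQ := hQ
  cover v := by simp only [mem_sdiff, mem_univ, mem_union, true_and]; tauto
  disjPQ := hd
  disjPR := Finset.disjoint_sdiff.mono_left Finset.subset_union_left
  disjQR := Finset.disjoint_sdiff.mono_left Finset.subset_union_right

/-- By Cauchy–Schwarz, d(v) + d(w) averages to at least 4e/n over the edges, and 4e/n ≥ (n - 3)²/n >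
n - 6. -/
theorem exists_adj_degree_add_gt [Fintype V] {n : ℕ} (hV : Fintype.card V = n)
    (he : ((n : ℝ) - 3) ^ 2 ≤ 4 * G.edgeFinset.card) (hn : 4 ≤ n) :
    ∃ a b, G.Adj a b ∧ n < G.degree a + G.degree b + 6 := by
  by_contra hcon
  push Not at hcon
  have hn' : (4 : ℝ) ≤ n := by exact_mod_cast hn
  set d : V → ℝ := fun v => (G.degree v : ℝ) with hd
  have h1 : ∀ v, ∀ w ∈ G.neighborFinset v, d v + d w ≤ (n : ℝ) - 6 := by
    intro v w hw
    have : ((G.degree v + G.degree w + 6 : ℕ) : ℝ) ≤ n := by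
      exact_mod_cast hcon v w (by simpa using hw)
    push_cast at this
    simp only [hd]
    linarith
  have hsum : ∑ v, d v = 2 * G.edgeFinset.card := by
    have := G.sum_degrees_eq_twice_card_edges
    simp only [hd]
    exact_mod_cast this
  have e1 : ∑ v, ∑ w ∈ G.neighborFinset v, d v = ∑ v, d v ^ 2 := by
    refine Finset.sum_congr rfl fun v _ => ?_
    rw [Finset.sum_const, SimpleGraph.card_neighborFinset_eq_degree, nsmul_eq_mul, sq]
  have e2 : ∑ v, ∑ w ∈ G.neighborFinset v, d w = ∑ v, d v ^ 2 := by
    rw [← e1]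
    exact sum_sum_neighborFinset_comm G (fun _ w => d w)
  have e3 : ∑ v, ∑ w ∈ G.neighborFinset v, (d v + d w) ≤
      ∑ v, ∑ w ∈ G.neighborFinset v, ((n : ℝ) - 6) :=
    Finset.sum_le_sum fun v _ => Finset.sum_le_sum (h1 v)
  have e4 : ∑ v, ∑ w ∈ G.neighborFinset v, ((n : ℝ) - 6) = (2 * G.edgeFinset.card) * (n - 6) := by
    rw [← hsum, Finset.sum_mul]
    refine Finset.sum_congr rfl fun v _ => ?_
    rw [Finset.sum_const, SimpleGraph.card_neighborFinset_eq_degree, nsmul_eq_mul]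
  have e5 : (∑ v, d v) ^ 2 ≤ n * ∑ v, d v ^ 2 := by
    have := sq_sum_le_card_mul_sum_sq (s := (univ : Finset V)) (f := d)
    rwa [Finset.card_univ, hV] at this
  simp only [Finset.sum_add_distrib] at e3
  rw [e1, e2, e4] at e3
  rw [hsum] at e5
  set e : ℝ := (G.edgeFinset.card : ℝ)
  have epos : 0 < e := by nlinarith
  have e6 : e * (4 * e) ≤ e * (n * (n - 6)) := by nlinarith
  have e7 := le_of_mul_le_mul_left e6 epos
  nlinarith

theorem degIn_le_of_adj {S : Finset V} (hG : G.CliqueFree 3) {v w : V} (h : G.Adj v w) :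
    degIn G S v + degIn G S w ≤ S.card := by
  rw [degIn, degIn, ← Finset.card_union_of_disjoint]
  · exact Finset.card_le_card (Finset.union_subset (Finset.filter_subset _ _)
      (Finset.filter_subset _ _))
  · rw [Finset.disjoint_left]
    intro x hx hx'
    rw [mem_filter] at hx hx'
    exact not_adj_of_common hG h hx.2 hx'.2

theorem sum_le_card_mul {ι : Type*} (S : Finset ι) (f : ι → ℕ) {c k : ℕ} (hS : S.card ≤ k)
    (hf : ∀ i ∈ S, f i ≤ c) : ∑ i ∈ S, f i ≤ k * c :=
  (Finset.sum_le_card_nsmul S f c hf).trans (by rw [smul_eq_mul]; exact Nat.mul_le_mul_right c hS)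

/-- If all vertices outside a bounded set `W` miss few vertices of the other side, then three
vertices suffice to make the graph bipartite. -/
theorem exists_nearBipartition_of_regular [Fintype V] {n : ℕ} (hV : Fintype.card V = n)
    (hn : 2000000 ≤ n) (hG : G.CliqueFree 3)
    (he : ((n : ℝ) - 3) ^ 2 ≤ 4 * G.edgeFinset.card) {P Q W : Finset V}
    (h : NearBipartition G P Q W) (hW : W.card ≤ 285)
    (hP : ∀ x ∈ P, 20 * Q.card ≤ n + 20 * degIn G Q x)
    (hQ : ∀ y ∈ Q, 20 * P.card ≤ n + 20 * degIn G P y) :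
    ∃ P Q R : Finset V, NearBipartition G P Q R ∧ R.card ≤ 3 := by
  have hcard := h.card_eq
  rw [hV] at hcard
  have hedges := h.twice_card_edges
  have hWW : ∑ u ∈ W, degIn G W u ≤ 285 * 285 :=
    sum_le_card_mul W _ hW fun u _ => (degIn_le_card G W u).trans hW
  have hpos : 0 < P.card * Q.card := by
    by_contra h0
    have h0 : P.card * Q.card = 0 := by omega
    have h1 : ∑ u ∈ W, (degIn G P u + degIn G Q u) ≤ 285 * n :=
      sum_le_card_mul W _ hW fun u _ => by
        have := degIn_le_card G P u
        have := degIn_le_card G Q u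
        omega
    rw [h0] at hedges
    have h2 : 4 * G.edgeFinset.card ≤ 2000 * n := by omega
    have h3 : (4 * G.edgeFinset.card : ℝ) ≤ 2000 * n := by exact_mod_cast h2
    have h4 : (2000000 : ℝ) ≤ n := by exact_mod_cast hn
    nlinarith
  have hPne : P.Nonempty := Finset.card_pos.1 (Nat.pos_of_mul_pos_right hpos)
  have hQne : Q.Nonempty := Finset.card_pos.1 (Nat.pos_of_mul_pos_left hpos)
  -- DA and DB hold the candidates for joining P and Q. A vertex of T has neighbours on both sides,
  -- each of which sees nearly all of the opposite side, so it has at most n/10 neighbours in P ∪ Q.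
  set DA := W.filter fun w => ∀ x ∈ P, ¬ G.Adj w x with hDA
  set DB := W.filter fun w => ¬ (∀ x ∈ P, ¬ G.Adj w x) ∧ ∀ y ∈ Q, ¬ G.Adj w y with hDB
  set T := W.filter fun w => ¬ (∀ x ∈ P, ¬ G.Adj w x) ∧ ¬ ∀ y ∈ Q, ¬ G.Adj w y with hT
  have hAW : DA ⊆ W := Finset.filter_subset _ _
  have hBW : DB ⊆ W := Finset.filter_subset _ _
  have dAB : Disjoint DA DB := by
    rw [Finset.disjoint_left]
    intro w h1 h2
    rw [hDA, mem_filter] at h1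
    rw [hDB, mem_filter] at h2
    exact h2.2.1 h1.2
  have dABT : Disjoint (DA ∪ DB) T := by
    rw [Finset.disjoint_left]
    intro w h1 h2
    rw [mem_union, hDA, mem_filter, hDB, mem_filter] at h1
    rw [hT, mem_filter] at h2
    tauto
  have hWu : W = DA ∪ DB ∪ T := by
    ext w
    simp only [hDA, hDB, hT, mem_union, mem_filter]
    tauto
  have hWc : W.card = DA.card + DB.card + T.card := by
    conv_lhs => rw [hWu, Finset.card_union_of_disjoint dABT, Finset.card_union_of_disjoint dAB]
  -- DA need not be independent, but its vertices adjacent to one y0 are. Taking y0 of largest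
  -- degree α into DA loses no edges in the estimate: Q sends at most |Q|α edges to DA.
  obtain ⟨y0, hy0, hy0max⟩ := Finset.exists_max_image Q (degIn G DA) hQne
  obtain ⟨x0, hx0, hx0max⟩ := Finset.exists_max_image P (degIn G DB) hPne
  set α := degIn G DA y0 with hα
  set β := degIn G DB x0 with hβ
  have hαle : α ≤ DA.card := degIn_le_card _ _ _
  have hβle : β ≤ DB.card := degIn_le_card _ _ _
  have sA : ∑ w ∈ DA, (degIn G P w + degIn G Q w) ≤ Q.card * α := by
    have : ∑ w ∈ DA, (degIn G P w + degIn G Q w) = ∑ w ∈ DA, degIn G Q w :=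
      Finset.sum_congr rfl fun w hw => by
        rw [degIn_eq_zero (S := P) (mem_filter.1 hw).2, zero_add]
    rw [this, sum_degIn_comm]
    exact sum_le_card_mul Q _ le_rfl hy0max
  have sB : ∑ w ∈ DB, (degIn G P w + degIn G Q w) ≤ P.card * β := by
    have : ∑ w ∈ DB, (degIn G P w + degIn G Q w) = ∑ w ∈ DB, degIn G P w :=
      Finset.sum_congr rfl fun w hw => by
        rw [degIn_eq_zero (S := Q) (mem_filter.1 hw).2.2, add_zero]
    rw [this, sum_degIn_comm]
    exact sum_le_card_mul P _ le_rfl hx0max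
  have sT : 10 * ∑ w ∈ T, (degIn G P w + degIn G Q w) ≤ T.card * n := by
    rw [Finset.mul_sum]
    refine sum_le_card_mul T _ le_rfl fun w hw => ?_
    have hw2 := (mem_filter.1 hw).2
    push Not at hw2
    obtain ⟨⟨x, hx, hwx⟩, y, hy, hwy⟩ := hw2
    have h1 := degIn_le_of_adj (S := Q) hG hwx
    have h2 := degIn_le_of_adj (S := P) hG hwy
    have h3 := hP x hx
    have h4 := hQ y hy
    omega
  have hsumW : ∑ u ∈ W, (degIn G P u + degIn G Q u) =
      ∑ w ∈ DA, (degIn G P w + degIn G Q w) + ∑ w ∈ DB, (degIn G P w + degIn G Q w) +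
        ∑ w ∈ T, (degIn G P w + degIn G Q w) := by
    conv_lhs => rw [hWu, Finset.sum_union dABT, Finset.sum_union dAB]
  set P' := P ∪ DA.filter (G.Adj y0) with hP'
  set Q' := Q ∪ DB.filter (G.Adj x0) with hQ'
  have hAf : DA.filter (G.Adj y0) ⊆ W := (Finset.filter_subset _ _).trans hAW
  have hBf : DB.filter (G.Adj x0) ⊆ W := (Finset.filter_subset _ _).trans hBW
  have cP' : P'.card = P.card + α :=
    Finset.card_union_of_disjoint (h.disjPR.mono_right hAf)
  have cQ' : Q'.card = Q.card + β :=
    Finset.card_union_of_disjoint (h.disjQR.mono_right hBf)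
  have dPQ' : Disjoint P' Q' := by
    rw [hP', hQ', Finset.disjoint_union_left, Finset.disjoint_union_right,
      Finset.disjoint_union_right]
    exact ⟨⟨h.disjPQ, h.disjPR.mono_right hBf⟩, (h.disjQR.mono_right hAf).symm,
      dAB.mono (Finset.filter_subset _ _) (Finset.filter_subset _ _)⟩
  have iP' : ∀ x ∈ P', ∀ y ∈ P', ¬ G.Adj x y := by
    intro x hx y hy hxy
    rw [hP', mem_union, mem_filter, hDA, mem_filter] at hx hy
    rcases hx with hx | hx <;> rcases hy with hy | hy
    · exact h.indepP x hx y hy hxy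
    · exact hy.1.2 x hx hxy.symm
    · exact hx.1.2 y hy hxy
    · exact not_adj_of_common hG hx.2 hy.2 hxy
  have iQ' : ∀ x ∈ Q', ∀ y ∈ Q', ¬ G.Adj x y := by
    intro x hx y hy hxy
    rw [hQ', mem_union, mem_filter, hDB, mem_filter] at hx hy
    rcases hx with hx | hx <;> rcases hy with hy | hy
    · exact h.indepQ x hx y hy hxy
    · exact hy.1.2.2 x hx hxy.symm
    · exact hx.1.2.2 y hy hxy
    · exact not_adj_of_common hG hx.2 hy.2 hxy
  have hnew := NearBipartition.of_disjoint iP' iQ' dPQ'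
  refine ⟨P', Q', _, hnew, ?_⟩
  have hcard' := hnew.card_eq
  set R := univ \ (P' ∪ Q')
  rw [hV, cP', cQ'] at hcard'
  by_contra hR
  push Not at hR
  have hTR : T.card ≤ R.card := by omega
  have hR285 : R.card ≤ 285 := by omega
  have hfin : 10 * (2 * G.edgeFinset.card) ≤
      20 * (P.card * Q.card + Q.card * α + P.card * β) + 2 * (T.card * n) + 10 * (285 * 285) := by
    omega
  have hfinR : (10 * (2 * G.edgeFinset.card) : ℝ) ≤
      20 * (P.card * Q.card + Q.card * α + P.card * β) + 2 * (T.card * n) + 10 * (285 * 285) := by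
    exact_mod_cast hfin
  have hnR : (2000000 : ℝ) ≤ n := by exact_mod_cast hn
  have hkR : (4 : ℝ) ≤ R.card := by exact_mod_cast hR
  have hkR' : (R.card : ℝ) ≤ 285 := by exact_mod_cast hR285
  have hTRR : (T.card : ℝ) ≤ R.card := by exact_mod_cast hTR
  have hcR : (n : ℝ) = P.card + α + (Q.card + β) + R.card := by exact_mod_cast hcard'
  set k : ℝ := (R.card : ℝ)
  set p : ℝ := (P.card : ℝ)
  set q : ℝ := (Q.card : ℝ)
  have hα0 : (0 : ℝ) ≤ α := Nat.cast_nonneg _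
  have hβ0 : (0 : ℝ) ≤ β := Nat.cast_nonneg _
  -- The bracket is at most |P'||Q'|. Each vertex left over lowers the bound on 4e by about 2n and
  -- returns at most 0.4n through T, so k ≥ 4 contradicts 4e ≥ (n - 3)².
  have b1 : 4 * (p * q + q * α + p * β) ≤ (n - k) ^ 2 := by
    have : (n : ℝ) - k = (p + α) + (q + β) := by rw [hcR]; ring
    rw [this]
    nlinarith [sq_nonneg ((p + α) - (q + β)), mul_nonneg hα0 hβ0]
  have b2 : (T.card : ℝ) * n ≤ k * n := by gcongr
  nlinarith [mul_nonneg (sub_nonneg.2 hkR) (sub_nonneg.2 hnR),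
    mul_nonneg (sub_nonneg.2 hkR) (sub_nonneg.2 hkR')]

/-- The neighbourhoods of the ends of an edge with large degree sum are disjoint independent sets
covering all but five vertices. Discarding vertices that miss many of the other side prepares for
`exists_nearBipartition_of_regular`. -/
theorem exists_nearBipartition [Fintype V] {n : ℕ} (hV : Fintype.card V = n) (hn : 2000000 ≤ n)
    (hG : G.CliqueFree 3) (he : ((n : ℝ) - 3) ^ 2 ≤ 4 * G.edgeFinset.card) :
    ∃ P Q R : Finset V, NearBipartition G P Q R ∧ R.card ≤ 3 := by
  obtain ⟨a, b, hab, hdeg⟩ := exists_adj_degree_add_gt hV he (by omega)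
  have indep : ∀ v, ∀ x ∈ G.neighborFinset v, ∀ y ∈ G.neighborFinset v, ¬ G.Adj x y := by
    intro v x hx y hy
    rw [SimpleGraph.mem_neighborFinset] at hx hy
    exact not_adj_of_common hG hx hy
  have hd : Disjoint (G.neighborFinset b) (G.neighborFinset a) := by
    rw [Finset.disjoint_left]
    intro x hx hx'
    rw [SimpleGraph.mem_neighborFinset] at hx hx'
    exact not_adj_of_common hG hab hx' hx
  have h := NearBipartition.of_disjoint (indep b) (indep a) hd
  set P := G.neighborFinset b
  set Q := G.neighborFinset a
  set R := univ \ (P ∪ Q)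
  have hcard := h.card_eq
  rw [hV] at hcard
  have cP : P.card = G.degree b := G.card_neighborFinset_eq_degree b
  have cQ : Q.card = G.degree a := G.card_neighborFinset_eq_degree a
  have hR : R.card ≤ 5 := by omega
  have hm : (missing G P Q).card ≤ 7 * n := by
    have h1 : ∑ u ∈ R, (degIn G P u + degIn G Q u) ≤ 5 * n :=
      sum_le_card_mul R _ hR fun u _ => by
        have := degIn_le_card G P u
        have := degIn_le_card G Q u
        omega
    have h2 : ∑ u ∈ R, degIn G R u ≤ 5 * 5 :=
      sum_le_card_mul R _ hR fun u _ => (degIn_le_card G R u).trans hR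
    have h3 := h.twice_card_edges
    have h4 : 2 * G.edgeFinset.card + 2 * (missing G P Q).card ≤
        2 * (P.card * Q.card) + 2 * (5 * n) + 25 := by omega
    have h5 : (2 * G.edgeFinset.card + 2 * (missing G P Q).card : ℝ) ≤
        2 * (P.card * Q.card) + 2 * (5 * n) + 25 := by exact_mod_cast h4
    have h6 : (P.card : ℝ) + Q.card ≤ n := by
      exact_mod_cast (show P.card + Q.card ≤ n by omega)
    have hnR : (2000000 : ℝ) ≤ n := by exact_mod_cast hn
    have h7 : 4 * ((P.card : ℝ) * Q.card) ≤ n ^ 2 := by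
      have h8 : ((P.card : ℝ) + Q.card) ^ 2 ≤ n ^ 2 := pow_le_pow_left₀ (by positivity) h6 2
      nlinarith [sq_nonneg ((P.card : ℝ) - Q.card)]
    have h8 : ((missing G P Q).card : ℝ) ≤ 7 * n := by nlinarith
    exact_mod_cast h8
  -- With at most 7n missing pairs, at most 140 vertices per side miss more than n/20; hence the
  -- bound 285 = 5 + 2 · 140 on the remainder.
  have bound : ∀ A B : Finset V, (missing G A B).card ≤ 7 * n →
      (A.filter fun x => n < 20 * (B.card - degIn G B x)).card ≤ 140 := by
    intro A B hAB
    set D := A.filter fun x => n < 20 * (B.card - degIn G B x) with hD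
    have h1 : D.card * n ≤ 20 * (missing G A B).card := by
      rw [card_missing_eq_sum, Finset.mul_sum, ← smul_eq_mul, ← Finset.sum_const]
      calc ∑ x ∈ D, n ≤ ∑ x ∈ D, 20 * (B.card - degIn G B x) :=
            Finset.sum_le_sum fun x hx => (mem_filter.1 hx).2.le
        _ ≤ _ := Finset.sum_le_sum_of_subset (Finset.filter_subset _ _)
    have h2 : D.card * n ≤ 140 * n := by omega
    exact Nat.le_of_mul_le_mul_right h2 (by omega)
  set DP := P.filter fun x => n < 20 * (Q.card - degIn G Q x) with hDP
  set DQ := Q.filter fun x => n < 20 * (P.card - degIn G P x) with hDQ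
  have cDP : DP.card ≤ 140 := bound P Q hm
  have cDQ : DQ.card ≤ 140 := bound Q P (by rw [missing_swap]; exact hm)
  have cDP' := Finset.card_sdiff_add_card_eq_card (Finset.filter_subset
    (fun x => n < 20 * (Q.card - degIn G Q x)) P)
  have cDQ' := Finset.card_sdiff_add_card_eq_card (Finset.filter_subset
    (fun x => n < 20 * (P.card - degIn G P x)) Q)
  rw [← hDP] at cDP'
  rw [← hDQ] at cDQ'
  have h' : NearBipartition G (P \ DP) (Q \ DQ) (univ \ ((P \ DP) ∪ (Q \ DQ))) :=
    NearBipartition.of_disjoint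
      (fun x hx y hy => h.indepP x (mem_sdiff.1 hx).1 y (mem_sdiff.1 hy).1)
      (fun x hx y hy => h.indepQ x (mem_sdiff.1 hx).1 y (mem_sdiff.1 hy).1)
      (hd.mono Finset.sdiff_subset Finset.sdiff_subset)
  have hcard' := h'.card_eq
  rw [hV] at hcard'
  have mono : ∀ (A D : Finset V) (x : V), D ⊆ A → (A \ D).card + degIn G A x ≤
      A.card + degIn G (A \ D) x := by
    intro A D x hDA
    have h1 := degIn_union G (Finset.sdiff_disjoint : Disjoint (A \ D) D) x
    rw [Finset.sdiff_union_of_subset hDA] at h1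
    have h2 := degIn_le_card G D x
    have h3 := Finset.card_sdiff_add_card_eq_card hDA
    omega
  refine exists_nearBipartition_of_regular hV hn hG he h' (by omega) ?_ ?_
  · intro x hx
    rw [mem_sdiff, hDP, mem_filter] at hx
    have h1 : ¬ n < 20 * (Q.card - degIn G Q x) := fun hlt => hx.2 ⟨hx.1, hlt⟩
    have h2 := mono Q DQ x (Finset.filter_subset _ _)
    have h3 := degIn_le_card G Q x
    omega
  · intro x hx
    rw [mem_sdiff, hDQ, mem_filter] at hx
    have h1 : ¬ n < 20 * (P.card - degIn G P x) := fun hlt => hx.2 ⟨hx.1, hlt⟩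
    have h2 := mono P DP x (Finset.filter_subset _ _)
    have h3 := degIn_le_card G P x
    omega

theorem mul_le_of_add_eq {n p q : ℕ} (hpq : p + q = n - 3) :
    p * q ≤ (n - 3) / 2 * ((n - 2) / 2) := by
  obtain ⟨m, hm⟩ := Nat.even_or_odd' (n - 3)
  rcases hm with hm | hm
  · have h1 : (n - 3) / 2 = m := by omega
    have h2 : (n - 2) / 2 = m := by omega
    rw [h1, h2]
    zify at *
    have : (q : ℤ) = 2 * m - p := by omega
    rw [this]
    nlinarith [sq_nonneg ((p : ℤ) - m)]
  · have h1 : (n - 3) / 2 = m := by omega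
    have h2 : (n - 2) / 2 = m + 1 := by omega
    rw [h1, h2]
    have : (q : ℤ) = 2 * m + 1 - p := by omega
    zify
    rw [this]
    rcases le_or_gt p m with hp | hp
    · have : (p : ℤ) ≤ m := by exact_mod_cast hp
      nlinarith
    · have : (m : ℤ) + 1 ≤ p := by exact_mod_cast hp
      nlinarith

/-- The edge bound for triangle-free graphs that are not 3-colourable. -/
theorem card_edges_le_of_not_colorable [Fintype V] {n : ℕ} (hV : Fintype.card V = n) (hn : 2000000 ≤ n)
    (hG : G.CliqueFree 3) (hχ : ¬ G.Colorable 3) :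
    G.edgeFinset.card ≤ (n - 3) / 2 * ((n - 2) / 2) + 5 := by
  by_cases he : ((n : ℝ) - 3) ^ 2 ≤ 4 * G.edgeFinset.card
  · obtain ⟨P, Q, R, h, hR⟩ := exists_nearBipartition hV hn hG he
    obtain ⟨u1, u2, u3, v13, v23, w13, w23, c⟩ := exists_grotzschCore h hG hχ hR
    have h1 := c.card_edges_le h hG
    have h2 := h.card_eq
    rw [hV, c.card_R] at h2
    have h3 := mul_le_of_add_eq (n := n) (p := P.card) (q := Q.card) (by omega)
    omega
  · push Not at he
    have h1 : (n : ℝ) - 3 = ((n - 3 : ℕ) : ℝ) := by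
      rw [Nat.cast_sub (by omega)]
      norm_num
    rw [h1] at he
    have h2 : 4 * G.edgeFinset.card < (n - 3) ^ 2 := by exact_mod_cast he
    obtain ⟨m, hm⟩ := Nat.even_or_odd' (n - 3)
    rcases hm with hm | hm
    · have h3 : (n - 3) / 2 = m := by omega
      have h4 : (n - 2) / 2 = m := by omega
      rw [h3, h4]
      rw [hm] at h2
      nlinarith
    · have h3 : (n - 3) / 2 = m := by omega
      have h4 : (n - 2) / 2 = m + 1 := by omega
      rw [h3, h4]
      rw [hm] at h2
      nlinarith

end Structure

/-! ### Perron vectors and the partition they induce. -/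

section SpectralStructure
open Finset
open scoped Classical

variable {V : Type*} [Fintype V] {G : SimpleGraph V}

theorem sum_sum_neighborFinset (G : SimpleGraph V) (B : Finset V) (f : V → ℝ) :
    ∑ y ∈ B, ∑ w ∈ G.neighborFinset y, f w = ∑ w, (degIn G B w : ℝ) * f w := by
  simp only [sum_neighborFinset_eq_sum_ite]
  rw [Finset.sum_comm]
  refine Finset.sum_congr rfl fun w _ => ?_
  rw [← Finset.sum_filter, Finset.sum_const, nsmul_eq_mul, degIn]
  simp only [G.adj_comm w]

theorem sum_eq_add_compl (B : Finset V) (f : V → ℝ) :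
    ∑ v, f v = ∑ v ∈ B, f v + ∑ v ∈ univ \ B, f v := by
  rw [add_comm, Finset.sum_sdiff (Finset.subset_univ B)]

/-- A nonnegative eigenvector of the adjacency matrix with maximum entry `z a = 1`. -/
structure PerronVector (G : SimpleGraph V) (ρ : ℝ) (z : V → ℝ) (a : V) : Prop where
  nonneg : ∀ v, 0 ≤ z v
  le_one : ∀ v, z v ≤ 1
  apply_eq_one : z a = 1
  eigen : ∀ v, ∑ w ∈ G.neighborFinset v, z w = ρ * z v

theorem exists_perronVector [Nonempty V] (G : SimpleGraph V) :
    ∃ z a, PerronVector G (graphIndex G) z a := by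
  obtain ⟨-, -, ⟨z, hz, hz0, he⟩, -⟩ := graphIndex_spec G
  obtain ⟨a, -, ha⟩ := Finset.exists_max_image (univ : Finset V) z univ_nonempty
  have hpos : 0 < z a := by
    obtain ⟨v, hv⟩ := Function.ne_iff.1 hz0
    exact lt_of_lt_of_le (lt_of_le_of_ne (hz v) (Ne.symm hv)) (ha v (mem_univ v))
  refine ⟨fun v => z v / z a, a, fun v => div_nonneg (hz v) hpos.le,
    fun v => (div_le_one hpos).2 (ha v (mem_univ v)), div_self hpos.ne', fun v => ?_⟩
  rw [← Finset.sum_div, he, mul_div_assoc]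

namespace PerronVector

variable {ρ : ℝ} {z : V → ℝ} {a : V}

theorem mul_le_degree (hz : PerronVector G ρ z a) (v : V) : ρ * z v ≤ G.degree v := by
  rw [← hz.eigen, ← SimpleGraph.card_neighborFinset_eq_degree]
  calc _ ≤ ∑ w ∈ G.neighborFinset v, (1 : ℝ) := Finset.sum_le_sum fun w _ => hz.le_one w
    _ = _ := by simp

theorem sq_mul (hz : PerronVector G ρ z a) (v : V) :
    ρ ^ 2 * z v = ∑ w, (degIn G (G.neighborFinset v) w : ℝ) * z w := by
  rw [← sum_sum_neighborFinset, sq, mul_assoc, ← hz.eigen, Finset.mul_sum]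
  exact Finset.sum_congr rfl fun y _ => (hz.eigen y).symm

end PerronVector

theorem degIn_neighborFinset_of_mem (hG : G.CliqueFree 3) {v y : V}
    (hy : y ∈ G.neighborFinset v) : degIn G (G.neighborFinset v) y = 0 := by
  rw [SimpleGraph.mem_neighborFinset] at hy
  refine degIn_eq_zero fun w hw => ?_
  rw [SimpleGraph.mem_neighborFinset] at hw
  exact not_adj_of_common hG hy hw

theorem degree_eq_add_compl (G : SimpleGraph V) (B : Finset V) (v : V) :
    G.degree v = degIn G B v + degIn G (univ \ B) v := by
  rw [degree_eq_degIn_univ, ← degIn_union G Finset.disjoint_sdiff, Finset.union_sdiff_of_subset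
    (Finset.subset_univ B)]

theorem twice_card_edges_neighborFinset (hG : G.CliqueFree 3) (a : V) :
    2 * G.edgeFinset.card =
      2 * ∑ w ∈ univ \ G.neighborFinset a, degIn G (G.neighborFinset a) w +
        ∑ w ∈ univ \ G.neighborFinset a, degIn G (univ \ G.neighborFinset a) w := by
  set B := G.neighborFinset a with hB
  rw [← G.sum_degrees_eq_twice_card_edges, ← Finset.sum_sdiff (Finset.subset_univ B)]
  have h1 : ∑ v ∈ B, G.degree v = ∑ w ∈ univ \ B, degIn G B w := by
    rw [sum_degIn_comm]
    refine Finset.sum_congr rfl fun v hv => ?_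
    rw [degree_eq_add_compl G B, degIn_neighborFinset_of_mem hG hv, zero_add]
  have h2 : ∑ v ∈ univ \ B, G.degree v =
      ∑ w ∈ univ \ B, degIn G B w + ∑ w ∈ univ \ B, degIn G (univ \ B) w := by
    rw [← Finset.sum_add_distrib]
    exact Finset.sum_congr rfl fun v _ => degree_eq_add_compl G B v
  rw [h1, h2]
  ring

/-- The defect of the two-step walk count at the maximum of the eigenvector. -/
theorem PerronVector.edge_defect {ρ : ℝ} {z : V → ℝ} {a : V} (hz : PerronVector G ρ z a)
    (hG : G.CliqueFree 3) :
    2 * (G.edgeFinset.card - ρ ^ 2) =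
      2 * ∑ w ∈ univ \ G.neighborFinset a, (degIn G (G.neighborFinset a) w : ℝ) * (1 - z w) +
        ∑ w ∈ univ \ G.neighborFinset a, (degIn G (univ \ G.neighborFinset a) w : ℝ) := by
  have h1 := hz.sq_mul a
  rw [hz.apply_eq_one, mul_one, sum_eq_add_compl (G.neighborFinset a)] at h1
  have h2 : ∑ v ∈ G.neighborFinset a, (degIn G (G.neighborFinset a) v : ℝ) * z v = 0 :=
    Finset.sum_eq_zero fun v hv => by rw [degIn_neighborFinset_of_mem hG hv]; simp
  rw [h2, zero_add] at h1
  have h3 : (2 * G.edgeFinset.card : ℝ) =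
      2 * ∑ w ∈ univ \ G.neighborFinset a, (degIn G (G.neighborFinset a) w : ℝ) +
        ∑ w ∈ univ \ G.neighborFinset a, (degIn G (univ \ G.neighborFinset a) w : ℝ) := by
    exact_mod_cast twice_card_edges_neighborFinset hG a
  simp only [mul_sub, mul_one, Finset.sum_sub_distrib]
  rw [h3, h1]
  ring

/-- The second-side analogue of `PerronVector.edge_defect`. -/
theorem PerronVector.neighbor_defect {ρ : ℝ} {z : V → ℝ} {a b : V} (hz : PerronVector G ρ z a)
    (hG : G.CliqueFree 3) (hb : b ∈ G.neighborFinset a) :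
    ∑ w ∈ G.neighborFinset a, (degIn G (G.neighborFinset b) w : ℝ) * (z b - z w) ≤
      (G.edgeFinset.card - ρ ^ 2) * z b +
        ∑ w ∈ univ \ G.neighborFinset a, (degIn G (univ \ G.neighborFinset a) w : ℝ) := by
  set B := G.neighborFinset a with hB
  have hNb : G.neighborFinset b ⊆ univ \ B := by
    intro w hw
    rw [mem_sdiff, hB, SimpleGraph.mem_neighborFinset]
    rw [SimpleGraph.mem_neighborFinset] at hw
    rw [hB, SimpleGraph.mem_neighborFinset] at hb
    exact ⟨mem_univ w, fun h => not_adj_of_common hG hb h hw⟩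
  have h1 := hz.sq_mul b
  rw [sum_eq_add_compl B] at h1
  have h2 : ∑ w ∈ univ \ B, (degIn G (G.neighborFinset b) w : ℝ) * z w ≤
      ∑ w ∈ univ \ B, (degIn G (univ \ B) w : ℝ) := by
    refine Finset.sum_le_sum fun w _ => ?_
    have h3 : (degIn G (G.neighborFinset b) w : ℝ) ≤ degIn G (univ \ B) w := by
      exact_mod_cast degIn_mono G hNb w
    calc _ ≤ (degIn G (G.neighborFinset b) w : ℝ) * 1 := by
          gcongr
          exact hz.le_one w
      _ ≤ _ := by rw [mul_one]; exact h3
  have h4 : ∑ w ∈ B, (degIn G (G.neighborFinset b) w : ℝ) ≤ G.edgeFinset.card := by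
    have h5 : ∑ w ∈ B, degIn G (G.neighborFinset b) w ≤ ∑ w ∈ univ \ B, degIn G B w := by
      rw [sum_degIn_comm G (univ \ B) B]
      exact Finset.sum_le_sum fun w _ => degIn_mono G hNb w
    have h6 := twice_card_edges_neighborFinset hG a
    rw [← hB] at h6
    exact_mod_cast (show ∑ w ∈ B, degIn G (G.neighborFinset b) w ≤ G.edgeFinset.card by omega)
  have h7 := mul_le_mul_of_nonneg_right h4 (hz.nonneg b)
  simp only [mul_sub, Finset.sum_sub_distrib, ← Finset.sum_mul]
  nlinarith

/-- The data extracted from an eigenvector of a dense triangle-free graph: up to three vertices of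
low degree, and two independent sets of vertices of high degree. -/
structure DensePartition (G : SimpleGraph V) (n : ℕ) (z : V → ℝ) (a : V) (P Q R : Finset V) :
    Prop where
  nearBip : NearBipartition G P Q R
  card_le : R.card ≤ 3
  adj_a : ∀ y ∈ Q, G.Adj a y
  low : ∀ u ∈ R, 20 * (G.degree u : ℝ) ≤ n
  high : ∀ v ∈ Q, 0.45 * (n : ℝ) ≤ G.degree v
  sum_P : (∑ x ∈ P, (1 - z x)) * n ≤ 43

/-- With k = |R|, the low degrees give (n - 3)² ≤ (n - k)² + kn/5 + 52, which fails for k ≥ 4. -/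
theorem NearBipartition.card_le_three_of_low {n : ℕ} {P Q R : Finset V}
    (h : NearBipartition G P Q R) (hV : Fintype.card V = n) (hn : 1000 ≤ n)
    (he : ((n : ℝ) - 3) ^ 2 ≤ 4 * G.edgeFinset.card + 52)
    (hlow : ∀ u ∈ R, 20 * (G.degree u : ℝ) ≤ n) : R.card ≤ 3 := by
  have hnR : (1000 : ℝ) ≤ n := by exact_mod_cast hn
  have h1 := h.twice_card_edges
  have h2 : 20 * ∑ u ∈ R, (G.degree u : ℝ) ≤ R.card * n := by
    rw [Finset.mul_sum, ← nsmul_eq_mul]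
    exact Finset.sum_le_card_nsmul R _ _ hlow
  have h3 : ∑ u ∈ R, (G.degree u : ℝ) =
      ((∑ u ∈ R, (degIn G P u + degIn G Q u) + ∑ u ∈ R, degIn G R u : ℕ) : ℝ) := by
    rw [← Finset.sum_add_distrib, Nat.cast_sum]
    exact Finset.sum_congr rfl fun u _ => by rw [h.degree_eq u]
  have h4 : (2 * G.edgeFinset.card : ℝ) ≤ 2 * (P.card * Q.card) +
      2 * ((∑ u ∈ R, (degIn G P u + degIn G Q u) + ∑ u ∈ R, degIn G R u : ℕ) : ℝ) := by
    exact_mod_cast (show 2 * G.edgeFinset.card ≤ 2 * (P.card * Q.card) +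
      2 * (∑ u ∈ R, (degIn G P u + degIn G Q u) + ∑ u ∈ R, degIn G R u) by omega)
  rw [← h3] at h4
  have h5 : (n : ℝ) = P.card + Q.card + R.card := by
    rw [← hV]
    exact_mod_cast h.card_eq
  by_contra hcon
  push Not at hcon
  have h6 : (4 : ℝ) ≤ R.card := by exact_mod_cast hcon
  set k : ℝ := (R.card : ℝ)
  have h7 : 4 * ((P.card : ℝ) * Q.card) ≤ (n - k) ^ 2 := by
    have : (n : ℝ) - k = P.card + Q.card := by rw [h5]; ring
    rw [this]
    nlinarith [sq_nonneg ((P.card : ℝ) - Q.card)]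
  have h8 : k ≤ n := by
    rw [h5]
    have : (0 : ℝ) ≤ P.card := Nat.cast_nonneg _
    have : (0 : ℝ) ≤ Q.card := Nat.cast_nonneg _
    linarith
  have h9 : ((n : ℝ) - 3) ^ 2 ≤ (n - k) ^ 2 + k * n / 5 + 52 := by linarith
  have h10 : k ≤ 8 := by
    by_contra hlt
    push Not at hlt
    nlinarith [mul_nonneg (sub_nonneg.2 h8) (show (0 : ℝ) ≤ k by linarith)]
  nlinarith [mul_nonneg (sub_nonneg.2 h6) (show (0 : ℝ) ≤ n - 20 by linarith)]

/-- Since e - ρ² ≤ 17, both walk-count defects are bounded. A vertex seeing a positive fraction of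
the reference neighbourhood then has entry near 1, hence degree near n/2; any other vertex has small
degree. There is nothing in between. -/
theorem PerronVector.exists_densePartition {n : ℕ} {ρ : ℝ} {z : V → ℝ} {a : V}
    (hz : PerronVector G ρ z a) (hG : G.CliqueFree 3) (hV : Fintype.card V = n)
    (hn : 10000000 ≤ n) (hρ0 : 0 ≤ ρ) (hρ : ((n : ℝ) - 3) ^ 2 ≤ 4 * ρ ^ 2 + 52)
    (he : (G.edgeFinset.card : ℝ) ≤ ρ ^ 2 + 17) :
    ∃ P Q R : Finset V, DensePartition G n z a P Q R := by
  have hnR : (10000000 : ℝ) ≤ n := by exact_mod_cast hn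
  have hρl : 0.4999 * (n : ℝ) ≤ ρ := by
    by_contra hlt
    push Not at hlt
    nlinarith
  set B := G.neighborFinset a with hB
  set S := univ \ B with hS
  have hdef := hz.edge_defect hG
  rw [← hB, ← hS] at hdef
  have hnn1 : ∀ w ∈ S, 0 ≤ (degIn G B w : ℝ) * (1 - z w) := fun w _ =>
    mul_nonneg (Nat.cast_nonneg _) (sub_nonneg.2 (hz.le_one w))
  have hnn2 : ∀ w ∈ S, 0 ≤ (degIn G S w : ℝ) := fun w _ => Nat.cast_nonneg _
  have hs1 := Finset.sum_nonneg hnn1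
  have hs2 := Finset.sum_nonneg hnn2
  have f1 : ∑ w ∈ S, (degIn G B w : ℝ) * (1 - z w) ≤ 17 := by linarith
  have f2 : ∑ w ∈ S, (degIn G S w : ℝ) ≤ 34 := by linarith
  have heρ : ρ ^ 2 ≤ G.edgeFinset.card := by linarith
  have f1' : ∀ w ∈ S, (degIn G B w : ℝ) * (1 - z w) ≤ 17 := fun w hw =>
    (Finset.single_le_sum hnn1 hw).trans f1
  have f2' : ∀ w ∈ S, (degIn G S w : ℝ) ≤ 34 := fun w hw =>
    (Finset.single_le_sum hnn2 hw).trans f2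
  have hdegS : ∀ w, (G.degree w : ℝ) = degIn G B w + degIn G S w := fun w => by
    rw [degree_eq_add_compl G B w]
    push_cast
    rfl
  have hcBS : (B.card : ℝ) + S.card = n := by
    rw [← hV, ← Finset.card_univ, ← Finset.card_sdiff_add_card_eq_card (Finset.subset_univ B)]
    push_cast
    ring
  have hprod : ρ ^ 2 ≤ B.card * S.card := by
    have h1 := hz.sq_mul a
    rw [hz.apply_eq_one, mul_one, sum_eq_add_compl B] at h1
    have h2 : ∑ v ∈ B, (degIn G B v : ℝ) * z v = 0 :=
      Finset.sum_eq_zero fun v hv => by rw [degIn_neighborFinset_of_mem hG hv]; simp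
    rw [h2, zero_add] at h1
    rw [h1]
    calc _ ≤ ∑ w ∈ S, (B.card : ℝ) := by
          refine Finset.sum_le_sum fun w _ => ?_
          have h3 : (degIn G B w : ℝ) ≤ B.card := by exact_mod_cast degIn_le_card G B w
          nlinarith [hz.le_one w, hz.nonneg w]
      _ = _ := by rw [Finset.sum_const, nsmul_eq_mul, mul_comm]
  have hBl : 0.49 * (n : ℝ) ≤ B.card := by
    by_contra hlt
    push Not at hlt
    have : (S.card : ℝ) = n - B.card := by linarith
    rw [this] at hprod
    nlinarith [mul_pos (sub_pos.2 hlt) (show (0 : ℝ) < 0.51 * n - B.card by linarith)]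
  have hSl : 0.49 * (n : ℝ) ≤ S.card := by
    by_contra hlt
    push Not at hlt
    have : (B.card : ℝ) = n - S.card := by linarith
    rw [this] at hprod
    nlinarith [mul_pos (sub_pos.2 hlt) (show (0 : ℝ) < 0.51 * n - S.card by linarith)]
  -- the second side
  have hBne : B.Nonempty := Finset.card_pos.1 (by
    have : (0 : ℝ) < B.card := by linarith
    exact_mod_cast this)
  -- The maximum at a controls only vertices outside B = N(a); b plays the same role for those
  -- inside B.
  obtain ⟨b, hb, hbmax⟩ := Finset.exists_max_image B z hBne
  have hzb : 0.98 ≤ z b := by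
    have h1 := hz.eigen a
    rw [hz.apply_eq_one, mul_one, ← hB] at h1
    have h2 : ∑ w ∈ B, z w ≤ B.card * z b := by
      rw [← nsmul_eq_mul]
      exact Finset.sum_le_card_nsmul B z _ hbmax
    by_contra hlt
    push Not at hlt
    nlinarith [hz.nonneg b]
  have f3 : ∑ w ∈ B, (degIn G (G.neighborFinset b) w : ℝ) * (z b - z w) ≤ 51 := by
    refine (hz.neighbor_defect hG hb).trans ?_
    nlinarith [hz.le_one b, hz.nonneg b]
  have f3' : ∀ w ∈ B, (degIn G (G.neighborFinset b) w : ℝ) * (z b - z w) ≤ 51 := fun w hw =>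
    (Finset.single_le_sum (f := fun w => (degIn G (G.neighborFinset b) w : ℝ) * (z b - z w))
      (fun v hv => mul_nonneg (Nat.cast_nonneg _) (sub_nonneg.2 (hbmax v hv))) hw).trans f3
  have hdichS : ∀ w ∈ S, 20 * (G.degree w : ℝ) ≤ n ∨ 0.45 * (n : ℝ) ≤ G.degree w := by
    intro w hw
    have h1 := f2' w hw
    have h2 := f1' w hw
    have h3 := hdegS w
    by_cases hc : (degIn G B w : ℝ) ≤ n / 50
    · left; linarith
    · right
      push Not at hc
      have h4 : 0.99 ≤ z w := by
        by_contra hlt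
        push Not at hlt
        nlinarith
      have h5 := hz.mul_le_degree w
      nlinarith
  have hdichB : ∀ w ∈ B, 20 * (G.degree w : ℝ) ≤ n ∨ 0.45 * (n : ℝ) ≤ G.degree w := by
    intro w hw
    have h2 := f3' w hw
    by_cases hc : (degIn G (G.neighborFinset b) w : ℝ) ≤ n / 50
    · left
      have hNb : G.neighborFinset b ⊆ S := by
        intro v hv
        rw [hS, mem_sdiff, hB, SimpleGraph.mem_neighborFinset]
        rw [SimpleGraph.mem_neighborFinset] at hv
        rw [hB, SimpleGraph.mem_neighborFinset] at hb
        exact ⟨mem_univ v, fun h => not_adj_of_common hG hb h hv⟩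
      have h3 : (G.degree w : ℝ) = degIn G S w := by
        rw [hdegS, degIn_neighborFinset_of_mem hG hw]
        simp
      -- N(b) fills S up to about 0.02n vertices, so few neighbours in N(b) means few neighbours
      -- altogether.
      have h4 : (degIn G S w : ℝ) + G.degree b ≤ degIn G (G.neighborFinset b) w + S.card := by
        have h5 := degIn_union G (Finset.sdiff_disjoint : Disjoint (S \ G.neighborFinset b) _) w
        rw [Finset.sdiff_union_of_subset hNb] at h5
        have h6 := degIn_le_card G (S \ G.neighborFinset b) w
        have h7 := Finset.card_sdiff_add_card_eq_card hNb
        rw [SimpleGraph.card_neighborFinset_eq_degree] at h7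
        exact_mod_cast (show degIn G S w + G.degree b ≤
          degIn G (G.neighborFinset b) w + S.card by omega)
      have h5 := hz.mul_le_degree b
      nlinarith
    · right
      push Not at hc
      have h4 : 0.97 ≤ z w := by
        by_contra hlt
        push Not at hlt
        nlinarith
      have h5 := hz.mul_le_degree w
      nlinarith
  set L : V → Prop := fun w => 20 * (G.degree w : ℝ) ≤ n with hL
  set P := S.filter fun w => ¬ L w with hP
  set Q := B.filter fun w => ¬ L w with hQ
  have hPd : ∀ w ∈ P, 0.45 * (n : ℝ) - 34 ≤ degIn G B w := by
    intro w hw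
    rw [hP, mem_filter] at hw
    have h1 := (hdichS w hw.1).resolve_left hw.2
    have h2 := f2' w hw.1
    have h3 := hdegS w
    linarith
  -- Two vertices of P have degree sum into B near 0.9n, exceeding |B| ≤ 0.51n, so they share a
  -- neighbour and cannot be adjacent.
  have hnb : NearBipartition G P Q (univ \ (P ∪ Q)) := by
    refine NearBipartition.of_disjoint ?_ ?_ ?_
    · intro x hx y hy hxy
      have h1 := hPd x hx
      have h2 := hPd y hy
      have h3 : (degIn G B x : ℝ) + degIn G B y ≤ B.card := by
        exact_mod_cast degIn_le_of_adj (S := B) hG hxy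
      linarith
    · intro x hx y hy
      rw [hQ, mem_filter, hB, SimpleGraph.mem_neighborFinset] at hx hy
      exact not_adj_of_common hG hx.1 hy.1
    · exact Finset.sdiff_disjoint.mono (Finset.filter_subset _ _) (Finset.filter_subset _ _)
  have hlow : ∀ u ∈ univ \ (P ∪ Q), 20 * (G.degree u : ℝ) ≤ n := by
    intro u hu
    rw [mem_sdiff, mem_union, hP, hQ, mem_filter, mem_filter, hS, mem_sdiff] at hu
    by_contra hcon
    by_cases huB : u ∈ B
    · exact hu.2 (Or.inr ⟨huB, hcon⟩)
    · exact hu.2 (Or.inl ⟨⟨mem_univ u, huB⟩, hcon⟩)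
  refine ⟨P, Q, _, hnb, ?_, ?_, hlow, ?_, ?_⟩
  · exact hnb.card_le_three_of_low hV (by omega) (by linarith) hlow
  · intro y hy
    rw [hQ, mem_filter, hB, SimpleGraph.mem_neighborFinset] at hy
    exact hy.1
  · intro v hv
    rw [hQ, mem_filter] at hv
    exact (hdichB v hv.1).resolve_left hv.2
  · have h1 : ∑ x ∈ P, (1 - z x) * (0.4 * n) ≤ 17 := by
      refine le_trans ?_ f1
      calc ∑ x ∈ P, (1 - z x) * (0.4 * n) ≤ ∑ x ∈ P, (degIn G B x : ℝ) * (1 - z x) := by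
            refine Finset.sum_le_sum fun x hx => ?_
            rw [mul_comm]
            have h2 := hPd x hx
            have h3 : 0 ≤ 1 - z x := sub_nonneg.2 (hz.le_one x)
            gcongr
            linarith
        _ ≤ _ := Finset.sum_le_sum_of_subset_of_nonneg (Finset.filter_subset _ _)
            fun w hw _ => hnn1 w hw
    rw [← Finset.sum_mul] at h1
    linarith

end SpectralStructure

/-! ### The spectral radius in terms of missing pairs. -/

section SpectralCount
open Finset
open scoped Classical

variable {V : Type*} {G : SimpleGraph V} {n : ℕ} {ρ : ℝ} {z : V → ℝ} {a : V}
  {P Q R : Finset V}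

/-- The eigenvalue equations summed over P, written as the complete bipartite value minus missing
pairs plus the contribution of R. -/
theorem PerronVector.mul_sum_side [Fintype V] (hz : PerronVector G ρ z a) (h : NearBipartition G P Q R) :
    ρ * ∑ x ∈ P, z x = P.card * ∑ y ∈ Q, z y - ∑ y ∈ Q, ((P.card : ℝ) - degIn G P y) * z y +
      ∑ u ∈ R, (degIn G P u : ℝ) * z u := by
  have h1 : ρ * ∑ x ∈ P, z x = ∑ w, (degIn G P w : ℝ) * z w := by
    rw [← sum_sum_neighborFinset, Finset.mul_sum]
    exact Finset.sum_congr rfl fun x _ => (hz.eigen x).symm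
  have h2 : ∑ x ∈ P, (degIn G P x : ℝ) * z x = 0 :=
    Finset.sum_eq_zero fun x hx => by rw [h.degIn_P hx]; simp
  rw [h1, h.sum_eq, h2]
  simp only [sub_mul, Finset.sum_sub_distrib, ← Finset.mul_sum]
  ring

theorem sum_sub_degIn (G : SimpleGraph V) (P Q : Finset V) :
    ∑ y ∈ Q, ((P.card : ℝ) - degIn G P y) = (missing G P Q).card := by
  rw [← missing_swap, card_missing_eq_sum]
  push_cast
  exact Finset.sum_congr rfl fun y _ => by rw [Nat.cast_sub (degIn_le_card G P y)]

theorem mul_card_missing_le (G : SimpleGraph V) (P Q : Finset V) {c : ℝ}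
    (hc : ∀ y ∈ Q, c ≤ z y) :
    c * (missing G P Q).card ≤ ∑ y ∈ Q, ((P.card : ℝ) - degIn G P y) * z y := by
  rw [← sum_sub_degIn, Finset.mul_sum]
  refine Finset.sum_le_sum fun y hy => ?_
  rw [mul_comm]
  have h1 : (degIn G P y : ℝ) ≤ P.card := by exact_mod_cast degIn_le_card G P y
  exact mul_le_mul_of_nonneg_left (hc y hy) (sub_nonneg.2 h1)

/-- Each neighbour of u in P forms a missing pair with w. -/
theorem degIn_le_card_missing (hG : G.CliqueFree 3) {u w : V} (hw : w ∈ Q) (hu : G.Adj u w) :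
    degIn G P u ≤ (missing G P Q).card := by
  refine Finset.card_le_card_of_injOn (fun x => (x, w)) ?_ ?_
  · intro x hx
    rw [Finset.mem_coe, mem_filter] at hx
    exact Finset.mem_coe.2 (mem_missing.2 ⟨⟨hx.1, hw⟩, not_adj_of_common hG hx.2 hu⟩)
  · intro x _ y _ hxy
    exact (Prod.mk.inj hxy).1

theorem GrotzschCore.degIn_P_le {u1 u2 u3 v13 v23 w13 w23 : V}
    (c : GrotzschCore G P Q R u1 u2 u3 v13 v23 w13 w23) (hG : G.CliqueFree 3) {u : V}
    (hu : u ∈ R) : degIn G P u ≤ (missing G P Q).card := by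
  rw [c.eqR] at hu
  simp only [mem_insert, mem_singleton] at hu
  rcases hu with rfl | rfl | rfl
  · exact degIn_le_card_missing hG c.w13Q c.aw13_1
  · exact degIn_le_card_missing hG c.w23Q c.aw23_2
  · exact degIn_le_card_missing hG c.w13Q c.aw13_3

theorem GrotzschCore.degIn_Q_le {u1 u2 u3 v13 v23 w13 w23 : V}
    (c : GrotzschCore G P Q R u1 u2 u3 v13 v23 w13 w23) (hG : G.CliqueFree 3) {u : V}
    (hu : u ∈ R) : degIn G Q u ≤ (missing G P Q).card := by
  rw [← missing_swap]
  exact c.symm.degIn_P_le hG hu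

/-- Entries of the eigenvector on `Q` are at least `(d_P(y) - ∑ (1 - z)) / ρ`. -/
theorem PerronVector.degIn_le [Fintype V] (hz : PerronVector G ρ z a) (P : Finset V) (y : V) :
    (degIn G P y : ℝ) - ∑ x ∈ P, (1 - z x) ≤ ρ * z y := by
  have h1 : ∑ x ∈ P.filter (G.Adj y), (1 - z x) ≤ ∑ x ∈ P, (1 - z x) :=
    Finset.sum_le_sum_of_subset_of_nonneg (Finset.filter_subset _ _)
      fun x _ _ => sub_nonneg.2 (hz.le_one x)
  have h2 : ∑ x ∈ P.filter (G.Adj y), z x ≤ ρ * z y := by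
    rw [← hz.eigen]
    refine Finset.sum_le_sum_of_subset_of_nonneg ?_ fun x _ _ => hz.nonneg x
    intro x hx
    rw [mem_filter] at hx
    rw [SimpleGraph.mem_neighborFinset]
    exact hx.2
  rw [Finset.sum_sub_distrib, Finset.sum_const, nsmul_eq_mul, mul_one] at h1
  have h3 : ((P.filter (G.Adj y)).card : ℝ) = degIn G P y := rfl
  rw [h3] at h1
  linarith

theorem sum_R_le {u1 u2 u3 v13 v23 w13 w23 : V}
    (c : GrotzschCore G P Q R u1 u2 u3 v13 v23 w13 w23) {S : Finset V} {m ε : ℝ}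
    (hz0 : ∀ v, 0 ≤ z v) (hm : ∀ u ∈ R, (degIn G S u : ℝ) ≤ m) (hε : ∀ u ∈ R, z u ≤ ε)
    (hm0 : 0 ≤ m) : ∑ u ∈ R, (degIn G S u : ℝ) * z u ≤ 3 * (m * ε) := by
  have h1 : ∑ u ∈ R, (degIn G S u : ℝ) * z u ≤ R.card • (m * ε) :=
    Finset.sum_le_card_nsmul R _ _ fun u hu =>
      mul_le_mul (hm u hu) (hε u hu) (hz0 u) hm0
  rw [c.card_R] at h1
  simpa using h1

variable {u1 u2 u3 v13 v23 w13 w23 : V}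

/-- The number of missing pairs is bounded. -/
theorem DensePartition.card_missing_le [Fintype V] (D : DensePartition G n z a P Q R)
    (hz : PerronVector G ρ z a) (hG : G.CliqueFree 3)
    (c : GrotzschCore G P Q R u1 u2 u3 v13 v23 w13 w23) (hn : 10000000 ≤ n)
    (hρl : 0.4999 * (n : ℝ) ≤ ρ) (hρu : 2 * ρ ≤ n) : (missing G P Q).card ≤ 39 := by
  have hnR : (10000000 : ℝ) ≤ n := by exact_mod_cast hn
  have h := D.nearBip
  set ℓ : ℝ := ((missing G P Q).card : ℝ) with hℓ
  have hℓ0 : 0 ≤ ℓ := Nat.cast_nonneg _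
  set δ := ∑ x ∈ P, (1 - z x) with hδ
  have hδn : δ * n ≤ 43 := D.sum_P
  have hδ0 : 0 ≤ δ := Finset.sum_nonneg fun x _ => sub_nonneg.2 (hz.le_one x)
  have hδ1 : δ ≤ 1 := by nlinarith
  have hyQ : ∀ y ∈ Q, 0.89 ≤ z y := by
    intro y hy
    have h1 := hz.degIn_le P y
    have h2 := D.high y hy
    rw [h.degree_eq y, h.degIn_Q hy] at h2
    have h3 : (degIn G R y : ℝ) ≤ 3 := by
      exact_mod_cast (degIn_le_card G R y).trans D.card_le
    push_cast at h2
    by_contra hlt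
    push Not at hlt
    nlinarith [hz.nonneg y]
  have hzu : ∀ u ∈ R, z u ≤ 0.11 := by
    intro u hu
    have h1 := hz.mul_le_degree u
    have h2 := D.low u hu
    by_contra hlt
    push Not at hlt
    nlinarith
  have hr := sum_R_le c (S := P) (m := ℓ) (ε := 0.11) hz.nonneg
    (fun u hu => Nat.cast_le.2 (c.degIn_P_le hG hu)) hzu hℓ0
  have hm := mul_card_missing_le G P Q hyQ
  have hα := hz.mul_sum_side h
  have hαδ : ∑ x ∈ P, z x = P.card - δ := by
    rw [hδ, Finset.sum_sub_distrib]
    simp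
  have hβ : ∑ y ∈ Q, z y ≤ ρ := by
    have h1 := hz.eigen a
    rw [hz.apply_eq_one, mul_one] at h1
    rw [← h1]
    refine Finset.sum_le_sum_of_subset_of_nonneg ?_ fun x _ _ => hz.nonneg x
    intro y hy
    rw [SimpleGraph.mem_neighborFinset]
    exact D.adj_a y hy
  rw [hαδ] at hα
  have hβp := mul_le_mul_of_nonneg_left hβ (Nat.cast_nonneg (α := ℝ) P.card)
  -- Combining, (0.89 - 3 · 0.11)ℓ ≤ ρδ ≤ 43/2, which bounds ℓ below 40.
  have h4 : ρ * δ ≤ 22 := by nlinarith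
  have h5 : ℓ < 40 := by linarith
  have h6 : (missing G P Q).card < 40 := by
    rw [hℓ] at h5
    exact_mod_cast h5
  omega

/-- Sharp asymptotics: `ρ² ≤ pq - 2ℓ + o(1)`, where `ℓ` is the number of missing pairs. -/
theorem DensePartition.sq_le [Fintype V] (D : DensePartition G n z a P Q R)
    (hz : PerronVector G ρ z a) (hG : G.CliqueFree 3)
    (c : GrotzschCore G P Q R u1 u2 u3 v13 v23 w13 w23) (hV : Fintype.card V = n)
    (hn : 10000000 ≤ n) (hℓ6 : 6 ≤ (missing G P Q).card) (hρ0 : 0 ≤ ρ) (hρ : ((n : ℝ) - 3) ^ 2 ≤ 4 * ρ ^ 2 + 52) (hρu : 2 * ρ ≤ n)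
    (hpq : ((n : ℝ) - 3) ^ 2 ≤ 4 * (P.card * Q.card) + 72) :
    ρ ^ 2 ≤ P.card * Q.card - 2 * (missing G P Q).card + 0.1 := by
  have hnR : (10000000 : ℝ) ≤ n := by exact_mod_cast hn
  have hρl : (n : ℝ) / 2 - 3 ≤ ρ := by
    by_contra hlt
    push Not at hlt
    nlinarith
  have h := D.nearBip
  have hℓ39 := D.card_missing_le hz hG c hn (by linarith) hρu
  have hPu : ∀ u ∈ R, degIn G P u ≤ 39 := fun u hu => (c.degIn_P_le hG hu).trans hℓ39
  have hQu : ∀ u ∈ R, degIn G Q u ≤ 39 := fun u hu => (c.degIn_Q_le hG hu).trans hℓ39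
  have hcard : (P.card : ℝ) + Q.card = n - 3 := by
    have h1 := h.card_eq
    rw [hV, c.card_R] at h1
    rw [h1]
    push_cast
    ring
  have hℓ : ((missing G P Q).card : ℝ) ≤ 39 := by exact_mod_cast hℓ39
  set ℓ : ℝ := ((missing G P Q).card : ℝ) with hℓdef
  set p : ℝ := (P.card : ℝ) with hp
  set q : ℝ := (Q.card : ℝ) with hq
  have hℓ0 : 6 ≤ ℓ := by rw [hℓdef]; exact_mod_cast hℓ6
  have hpl : (n : ℝ) / 2 - 6 ≤ p := by
    by_contra hlt
    push Not at hlt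
    have : q = n - 3 - p := by linarith
    rw [this] at hpq
    nlinarith
  have hpu : p ≤ (n : ℝ) / 2 + 6 := by
    by_contra hlt
    push Not at hlt
    have : q = n - 3 - p := by linarith
    rw [this] at hpq
    nlinarith
  set δ := ∑ x ∈ P, (1 - z x) with hδ
  have hδn : δ * n ≤ 43 := D.sum_P
  have hδ0 : 0 ≤ δ := Finset.sum_nonneg fun x _ => sub_nonneg.2 (hz.le_one x)
  have hδ1 : δ ≤ 0.00001 := by nlinarith
  have hxP : ∀ x ∈ P, 0.9999 ≤ z x := by
    intro x hx
    have h1 := Finset.single_le_sum (f := fun x => 1 - z x)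
      (fun x _ => sub_nonneg.2 (hz.le_one x)) hx
    linarith
  have hyQ : ∀ y ∈ Q, 0.9999 ≤ z y := by
    intro y hy
    have h1 := hz.degIn_le P y
    have h2 : p - degIn G P y ≤ ℓ := by
      rw [hℓdef, ← sum_sub_degIn]
      exact Finset.single_le_sum (f := fun y => (P.card : ℝ) - degIn G P y)
        (fun y _ => sub_nonneg.2 (by exact_mod_cast degIn_le_card G P y)) hy
    by_contra hlt
    push Not at hlt
    nlinarith [hz.nonneg y]
  have hzu : ∀ u ∈ R, z u ≤ 0.00002 := by
    intro u hu
    -- Bounded ℓ makes degrees in R bounded: 39 into each side and 3 within R. Their entries are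
    -- therefore O(1/n).
    have h1 := hz.mul_le_degree u
    have h2 : G.degree u ≤ 81 := by
      have h3 := degIn_le_card G R u
      have h4 := D.card_le
      have h5 := hPu u hu
      have h6 := hQu u hu
      rw [h.degree_eq]
      omega
    have h3 : (G.degree u : ℝ) ≤ 81 := by exact_mod_cast h2
    by_contra hlt
    push Not at hlt
    nlinarith
  have hrP := sum_R_le c (S := P) (m := 39) (ε := 0.00002) hz.nonneg
    (fun u hu => by exact_mod_cast hPu u hu) hzu (by norm_num)
  have hrQ := sum_R_le c (S := Q) (m := 39) (ε := 0.00002) hz.nonneg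
    (fun u hu => by exact_mod_cast hQu u hu) hzu (by norm_num)
  have hmQ := mul_card_missing_le G P Q hyQ
  have hmP := mul_card_missing_le G Q P hxP
  rw [missing_swap] at hmP
  have hα := hz.mul_sum_side h
  have hβ := hz.mul_sum_side h.symm
  have hαp : ∑ x ∈ P, z x ≤ p := by
    have : ∑ x ∈ P, z x = p - δ := by
      rw [hδ, Finset.sum_sub_distrib]
      simp [hp]
    linarith
  have hα0 : 0 ≤ ∑ x ∈ P, z x := Finset.sum_nonneg fun x _ => hz.nonneg x
  set α := ∑ x ∈ P, z x
  set β := ∑ y ∈ Q, z y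
  set mQ := ∑ y ∈ Q, ((P.card : ℝ) - degIn G P y) * z y
  set mP := ∑ x ∈ P, ((Q.card : ℝ) - degIn G Q x) * z x
  set rP := ∑ u ∈ R, (degIn G P u : ℝ) * z u
  set rQ := ∑ u ∈ R, (degIn G Q u : ℝ) * z u
  -- Eliminating β between the two side equations. Each bracket is ℓ up to 0.01, and p, ρ and α are
  -- all close to n/2, so pq - ρ² is nearly 2ℓ or more.
  have key : (p * q - ρ ^ 2) * α = p * (mP - rQ) + ρ * (mQ - rP) := by
    have : ρ * (ρ * α) = p * (ρ * β) - ρ * mQ + ρ * rP := by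
      rw [hα]
      ring
    rw [hβ] at this
    linear_combination -this
  have k1 : ℓ - 0.01 ≤ mP - rQ := by linarith
  have k2 : ℓ - 0.01 ≤ mQ - rP := by linarith
  have k3 : (2 * p - 9) * (ℓ - 0.01) ≤ (p * q - ρ ^ 2) * α := by
    rw [key]
    have k5 : p * (ℓ - 0.01) ≤ p * (mP - rQ) := mul_le_mul_of_nonneg_left k1 (by linarith)
    have k6 : ρ * (ℓ - 0.01) ≤ ρ * (mQ - rP) := mul_le_mul_of_nonneg_left k2 hρ0
    have k7 : (p - 9) * (ℓ - 0.01) ≤ ρ * (ℓ - 0.01) :=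
      mul_le_mul_of_nonneg_right (by linarith) (by linarith)
    linarith
  by_contra hlt
  push Not at hlt
  have k4 : (p * q - ρ ^ 2) * α ≤ (2 * ℓ - 0.1) * p := by
    calc (p * q - ρ ^ 2) * α ≤ (2 * ℓ - 0.1) * α :=
          mul_le_mul_of_nonneg_right (by linarith) hα0
      _ ≤ _ := mul_le_mul_of_nonneg_left hαp (by linarith)
  nlinarith

end SpectralCount

/-! ### Exact comparison of the two near-balanced blow-ups. -/

section Comparison
open Finset
open scoped Classical

instance nonempty_F1Vertex (s t : ℕ) : Nonempty (Σ v : GrotzschVertex, Fin (F1Size s t v)) :=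
  ⟨⟨.u1, (⟨0, Nat.one_pos⟩ : Fin 1)⟩⟩

/-- A symmetric test vector that satisfies all eigenvalue equations except that on the copies of
`x`, where there is a strict inequality. -/
theorem lt_graphIndex_F1 {s t : ℕ} {l a c x u g w y : ℝ} (ha : l * a = u + g + t * y)
    (hc : l * c = u + w + t * y) (hu : l * u = u + w + c + a) (hg : l * g = 2 * w + 2 * a)
    (hw : l * w = u + g + c + s * x) (hy : l * y = 2 * a + 2 * c + s * x)
    (hx : l * x < 2 * w + t * y) (hx0 : 0 < x) (hs : 0 < s) : l < graphIndex (F1 s t) := by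
  obtain ⟨h0, -, -, hmax⟩ := graphIndex_spec (F1 s t)
  let f : GrotzschVertex → ℝ := fun v => match v with
    | .v13 | .v23 => a
    | .v1 | .v2 => c
    | .x => x
    | .u1 | .u2 => u
    | .u3 => g
    | .w13 | .w23 => w
    | .y => y
  have h := hmax (fun v => f v.1)
  rw [adjForm_F1] at h
  set N := ∑ v : Σ v : GrotzschVertex, Fin (F1Size s t v), f v.1 ^ 2 with hN
  have hN0 : 0 ≤ N := Finset.sum_nonneg fun _ _ => sq_nonneg _
  rw [sum_sq_F1] at hN
  simp only [f] at h hN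
  have hsR : (0 : ℝ) < s := by exact_mod_cast hs
  have h1 : 0 < s * x * (2 * w + t * y - l * x) :=
    mul_pos (mul_pos hsR hx0) (sub_pos.2 hx)
  -- Weight each equation by its entry and multiplicity and sum: the slack in the x-equation is
  -- exactly the Rayleigh form minus lN.
  have h2 : l * N + s * x * (2 * w + t * y - l * x) ≤ graphIndex (F1 s t) * N := by
    refine le_trans (le_of_eq ?_) h
    rw [hN]
    linear_combination 2 * a * ha + 2 * c * hc + 2 * u * hu + g * hg + 2 * w * hw + t * y * hy
  by_contra hle
  push Not at hle
  have := mul_le_mul_of_nonneg_right hle hN0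
  linarith

/-- The two relations left after eliminating all vertices except the copies of `x` and `y`. -/
theorem graphIndex_F1_relation {s t : ℕ} (hs : 0 < s) (ht : 0 < t) {l : ℝ}
    (hl : graphIndex (F1 s t) = l) :
    ∃ X Y : ℝ, 0 < X ∧ 0 < Y ∧
      (l * (l ^ 5 - l ^ 4 - 8 * l ^ 3 + 3 * l ^ 2 + 7 * l - 2) -
        t * (4 * l ^ 4 - 4 * l ^ 3 - 18 * l ^ 2 + 22 * l - 4)) * Y =
        t * (l ^ 5 - l ^ 4 - 6 * l ^ 3 + 9 * l ^ 2 - l - 2) * X ∧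
      (l * (l ^ 5 - l ^ 4 - 8 * l ^ 3 + 3 * l ^ 2 + 7 * l - 2) -
        s * (2 * l ^ 4 - 2 * l ^ 3 - 8 * l ^ 2 + 4 * l + 4)) * X =
        s * (l ^ 5 - l ^ 4 - 6 * l ^ 3 + 9 * l ^ 2 - l - 2) * Y := by
  obtain ⟨-, -, ⟨z, hz, hz0, he⟩, -⟩ := graphIndex_spec (F1 s t)
  rw [hl] at he
  set Z : GrotzschVertex → ℝ := fun w => ∑ i, z ⟨w, i⟩ with hZ
  have hZ0 : ∀ w, 0 ≤ Z w := fun w => Finset.sum_nonneg fun i _ => hz _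
  have hZe : ∀ v, (F1Size s t v : ℝ) * ∑ w ∈ grotzsch.neighborFinset v, Z w = l * Z v := by
    intro v
    have h1 : ∀ i : Fin (F1Size s t v), ∑ w ∈ grotzsch.neighborFinset v, Z w = l * z ⟨v, i⟩ := by
      intro i
      rw [← he]
      exact (blowUp_sum_neighborFinset grotzsch (F1Size s t) z ⟨v, i⟩).symm
    calc _ = ∑ i : Fin (F1Size s t v), ∑ w ∈ grotzsch.neighborFinset v, Z w := by
          rw [Finset.sum_const, card_univ, Fintype.card_fin, nsmul_eq_mul]
      _ = ∑ i, l * z ⟨v, i⟩ := Finset.sum_congr rfl fun i _ => h1 i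
      _ = _ := (Finset.mul_sum _ _ _).symm
  obtain ⟨h1, h2, h3, h4, h5, h6, h7, h8, h9, h10, h11⟩ := grotzsch_sum_neighbors Z
  have e1 := hZe .v13
  have e2 := hZe .v23
  have e3 := hZe .v1
  have e4 := hZe .v2
  have e5 := hZe .x
  have e6 := hZe .u1
  have e7 := hZe .u2
  have e8 := hZe .u3
  have e9 := hZe .w13
  have e10 := hZe .w23
  have e11 := hZe .y
  rw [h1] at e1
  rw [h2] at e2
  rw [h3] at e3
  rw [h4] at e4
  rw [h5] at e5
  rw [h6] at e6
  rw [h7] at e7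
  rw [h8] at e8
  rw [h9] at e9
  rw [h10] at e10
  rw [h11] at e11
  simp only [F1Size, Nat.cast_one, one_mul] at e1 e2 e3 e4 e5 e6 e7 e8 e9 e10 e11
  have hsR : (0 : ℝ) < s := by exact_mod_cast hs
  have htR : (0 : ℝ) < t := by exact_mod_cast ht
  have n1 := hZ0 .v13
  have n2 := hZ0 .v23
  have n3 := hZ0 .v1
  have n4 := hZ0 .v2
  have n5 := hZ0 .x
  have n6 := hZ0 .u1
  have n7 := hZ0 .u2
  have n8 := hZ0 .u3
  have n9 := hZ0 .w13
  have n10 := hZ0 .w23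
  have n11 := hZ0 .y
  -- Perron positivity by hand: a zero total on x forces its neighbours to vanish, and the zeros
  -- spread over the whole graph.
  have hX : Z .x ≠ 0 := by
    intro h0
    rw [h0, mul_zero] at e5
    have f5 := (mul_eq_zero.1 e5).resolve_left hsR.ne'
    have z9 : Z .w13 = 0 := by linarith
    have z10 : Z .w23 = 0 := by linarith
    have z11 : Z .y = 0 := by linarith
    rw [z9, mul_zero] at e9
    rw [z10, mul_zero] at e10
    have z6 : Z .u1 = 0 := by linarith
    have z7 : Z .u2 = 0 := by linarith
    have z8 : Z .u3 = 0 := by linarith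
    have z3 : Z .v1 = 0 := by linarith
    have z4 : Z .v2 = 0 := by linarith
    rw [z6, mul_zero] at e6
    rw [z7, mul_zero] at e7
    have z1 : Z .v13 = 0 := by linarith
    have z2 : Z .v23 = 0 := by linarith
    apply hz0
    funext p
    have hp : Z p.1 = 0 := by
      cases p.1 <;> assumption
    exact (Finset.sum_eq_zero_iff_of_nonneg fun i _ => hz _).1 hp p.2 (mem_univ _)
  have hY : Z .y ≠ 0 := by
    intro h0
    rw [h0, mul_zero] at e11
    have := (mul_eq_zero.1 e11).resolve_left htR.ne'
    exact hX (by linarith)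
  refine ⟨Z .x, Z .y, lt_of_le_of_ne n5 (Ne.symm hX), lt_of_le_of_ne n11 (Ne.symm hY), ?_, ?_⟩
  -- The symmetry exchanging indices 1 and 2 groups the nine unreplicated vertices into five
  -- classes. The quintic is the characteristic polynomial of that quotient, and the multipliers
  -- below are cofactors from Cramer's rule.
  · have hAC : (l ^ 5 - l ^ 4 - 8 * l ^ 3 + 3 * l ^ 2 + 7 * l - 2) *
        (Z .v13 + Z .v23 + (Z .v1 + Z .v2)) =
        (4 * l ^ 4 - 4 * l ^ 3 - 18 * l ^ 2 + 22 * l - 4) * Z .y +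
          (2 * l ^ 3 + 6 * l ^ 2 - 8 * l) * Z .x := by
      linear_combination -(l ^ 4 - l ^ 3 - 4 * l ^ 2 + 4 * l) * (e1 + e2) -
      (l ^ 4 - l ^ 3 - 5 * l ^ 2 + 7 * l - 2) * (e3 + e4) -
      (2 * l ^ 3 + l ^ 2 - 5 * l + 2) * (e6 + e7) -
      (2 * l ^ 3 - 2 * l) * e8 -
      (l ^ 3 + 3 * l ^ 2 - 4 * l) * (e9 + e10)
    linear_combination -(l ^ 5 - l ^ 4 - 8 * l ^ 3 + 3 * l ^ 2 + 7 * l - 2) * e11 + t * hAC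
  · have hW : (l ^ 5 - l ^ 4 - 8 * l ^ 3 + 3 * l ^ 2 + 7 * l - 2) * (Z .w13 + Z .w23) =
        (2 * l ^ 3 + 6 * l ^ 2 - 8 * l) * Z .y +
          (2 * l ^ 4 - 2 * l ^ 3 - 8 * l ^ 2 + 4 * l + 4) * Z .x := by
      linear_combination -(3 * l ^ 2 - l - 2) * (e1 + e2) -
      (l ^ 3 - 3 * l + 2) * (e3 + e4) -
      (l ^ 3 + l ^ 2 - 2) * (e6 + e7) -
      (2 * l ^ 3 - 2 * l ^ 2 - 2 * l + 2) * e8 -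
      (l ^ 4 - l ^ 3 - 4 * l ^ 2 + 2 * l + 2) * (e9 + e10)
    linear_combination -(l ^ 5 - l ^ 4 - 8 * l ^ 3 + 3 * l ^ 2 + 7 * l - 2) * e5 + s * hW

/-- Let F be the 2 × 2 determinant of the reduced relations. At l = ρ(F₁(s + 1, s + 2)) its own F
vanishes, while that of F₁(s, s + 3) is negative. This sign permits a positive test vector at l with
a strict inequality in one equation, so the index of F₁(s, s + 3) exceeds l. -/
theorem graphIndex_F1_lt {s : ℕ} (hs : 100 ≤ s) :
    graphIndex (F1 (s + 1) (s + 2)) < graphIndex (F1 s (s + 3)) := by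
  set l := graphIndex (F1 (s + 1) (s + 2)) with hl
  have hsR : (100 : ℝ) ≤ s := by exact_mod_cast hs
  have hl0 : 0 ≤ l := (graphIndex_spec (F1 (s + 1) (s + 2))).1
  have hl2 := graphIndex_F1_sq_ge (s := s + 1) (t := s + 2)
  rw [← hl] at hl2
  push_cast at hl2
  have hls : (s : ℝ) + 3 ≤ l := by
    by_contra hlt
    push Not at hlt
    nlinarith
  have hl10 : 100 ≤ l := by linarith
  obtain ⟨X, Y, hX, hY, r1, r2⟩ := graphIndex_F1_relation (by omega) (by omega) hl.symm
  push_cast at r1 r2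
  obtain ⟨D, hD⟩ : ∃ D, D = l ^ 5 - l ^ 4 - 8 * l ^ 3 + 3 * l ^ 2 + 7 * l - 2 := ⟨_, rfl⟩
  obtain ⟨A, hA⟩ : ∃ A, A = 4 * l ^ 4 - 4 * l ^ 3 - 18 * l ^ 2 + 22 * l - 4 := ⟨_, rfl⟩
  obtain ⟨B, hB⟩ : ∃ B, B = 2 * l ^ 4 - 2 * l ^ 3 - 8 * l ^ 2 + 4 * l + 4 := ⟨_, rfl⟩
  obtain ⟨E, hE⟩ : ∃ E, E = l ^ 5 - l ^ 4 - 6 * l ^ 3 + 9 * l ^ 2 - l - 2 := ⟨_, rfl⟩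
  rw [← hD, ← hA, ← hE] at r1
  rw [← hD, ← hB, ← hE] at r2
  obtain ⟨m, hm⟩ : ∃ m, m = l - 100 := ⟨_, rfl⟩
  have hm0 : 0 ≤ m := by linarith
  have hlm : l = m + 100 := by linarith
  have hD0 : 0 < D := by
    rw [hD, hlm]
    ring_nf
    positivity
  have hA0 : 0 < A := by
    rw [hA, hlm]
    ring_nf
    positivity
  have hDA : 0 < D - A := by
    rw [hD, hA, hlm]
    ring_nf
    positivity
  -- The left side is the difference of the two determinants; it no longer depends on s.
  have hdiff : 2 * E ^ 2 - 2 * A * B - l * D * (A - B) =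
      - (D * (14 * l ^ 3 - 28 * l ^ 2 - 6 * l + 20)) := by
    rw [hD, hA, hB, hE]
    ring
  have hcubic : 0 < 14 * l ^ 3 - 28 * l ^ 2 - 6 * l + 20 := by
    rw [hlm]
    ring_nf
    positivity
  have hF : (l * D - (s + 2) * A) * (l * D - (s + 1) * B) = (s + 1) * (s + 2) * E ^ 2 := by
    have hXY : X * Y ≠ 0 := (mul_pos hX hY).ne'
    apply mul_right_cancel₀ hXY
    linear_combination (l * D - (s + 1) * B) * X * r1 + (s + 2) * E * X * r2
  set X0 := l * D - (s + 3) * A with hX0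
  have hX0pos : 0 < X0 := by
    have : (s + 3) * A ≤ l * A := mul_le_mul_of_nonneg_right hls hA0.le
    have : 0 < l * (D - A) := mul_pos (by linarith) hDA
    linarith
  have hF' : (l * D - s * B) * X0 < s * (s + 3) * E ^ 2 := by
    have h1 := mul_pos hD0 hcubic
    have h2 : (l * D - s * B) * X0 - s * (s + 3) * E ^ 2 =
        2 * E ^ 2 - 2 * A * B - l * D * (A - B) := by
      rw [hX0]
      linear_combination hF
    rw [hdiff] at h2
    linarith
  set Y0 := (s + 3) * E with hY0
  have hs0 : (s : ℝ) ≠ 0 := by linarith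
  -- The class totals on x and y are D · X0 and D · Y0, with X0 : Y0 chosen to satisfy the
  -- y-relation exactly. The other entries solve the five-class system, scaled by D to avoid
  -- division; `hF'` is the remaining x-inequality.
  refine lt_graphIndex_F1 (s := s) (t := s + 3) (l := l)
    (a := ((2 * l ^ 4 - 2 * l ^ 3 - 8 * l ^ 2 + 8 * l) * Y0 + (6 * l ^ 2 - 2 * l - 4) * X0) / 2)
    (c := ((2 * l ^ 4 - 2 * l ^ 3 - 10 * l ^ 2 + 14 * l - 4) * Y0 +
      (2 * l ^ 3 - 6 * l + 4) * X0) / 2)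
    (u := ((4 * l ^ 3 + 2 * l ^ 2 - 10 * l + 4) * Y0 + (2 * l ^ 3 + 2 * l ^ 2 - 4) * X0) / 2)
    (g := (2 * l ^ 3 - 2 * l) * Y0 + (2 * l ^ 3 - 2 * l ^ 2 - 2 * l + 2) * X0)
    (w := ((2 * l ^ 3 + 6 * l ^ 2 - 8 * l) * Y0 + B * X0) / 2)
    (x := D * X0 / s) (y := D * E) ?_ ?_ ?_ ?_ ?_ ?_ ?_ ?_ (by omega)
  · push_cast
    rw [hY0, hD]
    ring
  · push_cast
    rw [hY0, hD, hB]
    ring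
  · rw [hB]
    ring
  · rw [hB]
    ring
  · rw [mul_div_cancel₀ _ hs0, hB, hD]
    ring
  · rw [mul_div_cancel₀ _ hs0]
    have h1 : l * (D * E) = A * Y0 + (E - D) * X0 + D * X0 := by
      rw [hX0, hY0]
      ring
    rw [h1, hA, hE, hD]
    ring
  · push_cast
    have h1 : 2 * (((2 * l ^ 3 + 6 * l ^ 2 - 8 * l) * Y0 + B * X0) / 2) = (E - D) * Y0 + B * X0 := by
      rw [hE, hD]
      ring
    rw [h1, ← mul_div_assoc, div_lt_iff₀ (by linarith), hY0]
    linarith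
  · have : (0 : ℝ) < s := by linarith
    positivity

end Comparison

/-! ### Uniqueness of the spectral extremal graph. -/

section Extremal
open scoped Classical

theorem PerronVector.sq_le_card_edges {V : Type*} [Fintype V] {G : SimpleGraph V} {ρ : ℝ}
    {z : V → ℝ} {a : V} (hz : PerronVector G ρ z a) (hG : G.CliqueFree 3) :
    ρ ^ 2 ≤ G.edgeFinset.card := by
  have h := hz.edge_defect hG
  have h1 : 0 ≤ ∑ w ∈ Finset.univ \ G.neighborFinset a,
      (degIn G (G.neighborFinset a) w : ℝ) * (1 - z w) :=
    Finset.sum_nonneg fun w _ => mul_nonneg (Nat.cast_nonneg _) (sub_nonneg.2 (hz.le_one w))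
  have h2 : 0 ≤ ∑ w ∈ Finset.univ \ G.neighborFinset a,
      (degIn G (Finset.univ \ G.neighborFinset a) w : ℝ) :=
    Finset.sum_nonneg fun w _ => Nat.cast_nonneg _
  linarith

theorem graphIndex_congr {V W : Type*} [Fintype V] [Fintype W] {G : SimpleGraph V}
    {H : SimpleGraph W} (e : G ≃g H) : graphIndex G = graphIndex H := by
  rw [graphIndex, graphIndex, graphSpectralRadius_congr e]

/-- A triangle-free graph that is not 3-colourable and whose spectral radius is at least that of
the balanced `F₁(s, t)` is isomorphic to `F₁(s, t)`. -/
theorem nonempty_iso_F1_of_graphIndex_le {V : Type*} [Fintype V] {G : SimpleGraph V} {n s t : ℕ}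
    (hV : Fintype.card V = n) (hn : 10000000 ≤ n) (hs : s + 4 = (n - 3) / 2)
    (ht : t + 2 = (n - 2) / 2) (hG : G.CliqueFree 3) (hχ : ¬ G.Colorable 3)
    (hle : graphIndex (F1 s t) ≤ graphIndex G) : Nonempty (G ≃g F1 s t) := by
  have : Nonempty V := Fintype.card_pos_iff.1 (by omega)
  have hρ0 : 0 ≤ graphIndex G := (graphIndex_spec G).1
  have hF0 : 0 ≤ graphIndex (F1 s t) := (graphIndex_spec (F1 s t)).1
  obtain ⟨z, a, hz⟩ := exists_perronVector G
  have hKρ : ((s : ℝ) + 4) * (t + 2) - 12 ≤ graphIndex G ^ 2 :=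
    graphIndex_F1_sq_ge.trans (pow_le_pow_left₀ hF0 hle 2)
  set ρ := graphIndex G with hρdef
  have hnR : (10000000 : ℝ) ≤ n := by exact_mod_cast hn
  have hsum : (s : ℝ) + 4 + (t + 2) = n - 3 := by
    have h1 : s + 4 + (t + 2) + 3 = n := by omega
    rw [← h1]
    push_cast
    ring
  have hdiff : ((t : ℝ) + 2 - (s + 4)) ^ 2 ≤ 1 := by
    rcases (by omega : t + 2 = s + 4 ∨ t + 2 = s + 5) with h | h
    · have h' : (t : ℝ) + 2 = s + 4 := by exact_mod_cast h
      rw [h']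
      norm_num
    · have h' : (t : ℝ) + 2 = s + 5 := by exact_mod_cast h
      rw [h']
      norm_num
  set K : ℝ := ((s : ℝ) + 4) * (t + 2) with hK
  have hKn : ((n : ℝ) - 3) ^ 2 ≤ 4 * K + 1 := by
    rw [← hsum, hK]
    nlinarith
  have hKn' : 4 * K ≤ ((n : ℝ) - 3) ^ 2 := by
    rw [← hsum, hK]
    nlinarith [sq_nonneg ((t : ℝ) + 2 - (s + 4))]
  have he : (G.edgeFinset.card : ℝ) ≤ K + 5 := by
    have := card_edges_le_of_not_colorable hV (by omega) hG hχ
    rw [← hs, ← ht] at this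
    rw [hK]
    exact_mod_cast this
  have hρe := hz.sq_le_card_edges hG
  have hρu : 2 * ρ ≤ n := by
    by_contra hlt
    push Not at hlt
    nlinarith
  obtain ⟨P, Q, R, D⟩ := hz.exists_densePartition hG hV hn hρ0 (by linarith) (by linarith)
  have h := D.nearBip
  obtain ⟨u1, u2, u3, v13, v23, w13, w23, c⟩ := exists_grotzschCore h hG hχ D.card_le
  obtain ⟨hℓ6, hiso⟩ := c.card_missing h hG hχ
  have hcard := h.card_eq
  rw [hV, c.card_R] at hcard
  have hpq1 : (G.edgeFinset.card : ℝ) ≤ P.card * Q.card + 5 := by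
    exact_mod_cast c.card_edges_le h hG
  have hsq := D.sq_le hz hG c hV hn hℓ6 hρ0 (by linarith) hρu (by linarith)
  -- The real error 0.1 is absorbed by integrality; with ℓ ≥ 6 and pq at most the balanced product,
  -- both must be equalities.
  have hint : (s + 4) * (t + 2) + 2 * (missing G P Q).card < P.card * Q.card + 13 := by
    have : K + 2 * (missing G P Q).card < P.card * Q.card + 13 := by linarith
    rw [hK] at this
    exact_mod_cast this
  have hmax := mul_le_of_add_eq (n := n) (p := P.card) (q := Q.card) (by omega)
  rw [← hs, ← ht] at hmax
  have hℓ : (missing G P Q).card = 6 := by omega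
  have hprod : P.card * Q.card = (s + 4) * (t + 2) := by omega
  have hPQ : (P.card = s + 4 ∧ Q.card = t + 2) ∨ (P.card = t + 2 ∧ Q.card = s + 4) := by
    have hadd : P.card + Q.card = s + 4 + (t + 2) := by omega
    have h0 : ((P.card : ℤ) - (s + 4)) * (P.card - (t + 2)) = 0 := by
      zify at hadd hprod
      linear_combination (P.card : ℤ) * hadd - hprod
    rcases mul_eq_zero.1 h0 with h1 | h1 <;> omega
  have hfinal : Nonempty (G ≃g F1 s t) ∨ Nonempty (G ≃g F1 (t - 2) (s + 2)) := by
    rcases hPQ with ⟨h1, h2⟩ | ⟨h1, h2⟩ <;> 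
        rw [h1, h2, show s + 4 - 4 = s by omega, show t + 2 - 2 = t by omega,
          show t + 2 - 4 = t - 2 by omega, show s + 4 - 2 = s + 2 by omega] at hiso
    · exact hiso hℓ
    · exact (hiso hℓ).symm
  rcases hfinal with h1 | ⟨⟨e⟩⟩
  · exact h1
  -- For equal sides the two candidates coincide; otherwise the second is F₁(s + 1, s + 2), whose
  -- index is too small.
  · rcases (by omega : t = s + 2 ∨ t = s + 3) with rfl | rfl
    · exact ⟨e⟩
    · exfalso
      have h2 := graphIndex_congr e
      have h3 := graphIndex_F1_lt (s := s) (by omega)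
      rw [show s + 3 - 2 = s + 1 by omega] at h2
      rw [hρdef, h2] at hle
      linarith

end Extremal

/-! ### Rounding, and the main theorem. -/

theorem floor_sub_eleven_div_two {n : ℕ} (hn : 11 ≤ n) :
    ⌊((n : ℚ) - 11) / 2⌋₊ = (n - 11) / 2 := by
  have h : (n : ℚ) - 11 = ((n - 11 : ℕ) : ℚ) := by
    rw [Nat.cast_sub hn]
    norm_num
  rw [h]
  exact Nat.floor_div_eq_div (n - 11) 2

theorem ceil_sub_seven_div_two {n : ℕ} (hn : 9 ≤ n) :
    ⌈((n : ℚ) - 7) / 2⌉₊ = (n - 6) / 2 := by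
  rw [Nat.ceil_eq_iff (by omega)]
  have h1 : 2 * ((n - 6) / 2) ≤ n - 6 := by omega
  have h2 : n - 7 ≤ 2 * ((n - 6) / 2) := by omega
  have h3 : n = n - 6 + 6 := by omega
  have h4 : n = n - 7 + 7 := by omega
  have h5 : (n : ℚ) = ((n - 6 : ℕ) : ℚ) + 6 := by exact_mod_cast h3
  have h6 : (n : ℚ) = ((n - 7 : ℕ) : ℚ) + 7 := by exact_mod_cast h4
  have h7 : (2 * ((n - 6) / 2 : ℕ) : ℚ) ≤ ((n - 6 : ℕ) : ℚ) := by exact_mod_cast h1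
  have h8 : ((n - 7 : ℕ) : ℚ) ≤ (2 * ((n - 6) / 2 : ℕ) : ℚ) := by exact_mod_cast h2
  rw [Nat.cast_sub (by omega : 1 ≤ (n - 6) / 2)]
  constructor
  · push_cast
    linarith
  · linarith

theorem theorem1p3 :
    ∃ N : ℕ, ∀ n : ℕ, N ≤ n → ∀ s t : ℕ,
      s = ⌊((n : ℚ) - 11) / 2⌋₊ → t = ⌈((n : ℚ) - 7) / 2⌉₊ →
        -- `F₁(s, t)` is an `n`-vertex triangle-free graph with chromatic number at least four
        Fintype.card (Σ v : GrotzschVertex, Fin (F1Size s t v)) = n ∧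
        TriangleFreeChiGeFour (F1 s t) ∧
        -- it is the unique graph of maximum spectral radius among these graphs
        (∀ G : SimpleGraph (Fin n), TriangleFreeChiGeFour G →
          graphSpectralRadius G ≤ graphSpectralRadius (F1 s t) ∧
          (graphSpectralRadius G = graphSpectralRadius (F1 s t) ↔ Nonempty (G ≃g F1 s t))) ∧
        -- it also has the maximum number of edges among these graphs
        (∀ G : SimpleGraph (Fin n), TriangleFreeChiGeFour G →
          G.edgeSet.ncard ≤ (F1 s t).edgeSet.ncard) := by
  classical
  refine ⟨10000000, fun n hn s t hs ht => ?_⟩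
  rw [floor_sub_eleven_div_two (by omega)] at hs
  rw [ceil_sub_seven_div_two (by omega)] at ht
  have hs' : s + 4 = (n - 3) / 2 := by omega
  have ht' : t + 2 = (n - 2) / 2 := by omega
  refine ⟨by rw [card_F1]; omega, triangleFreeChiGeFour_F1 (by omega) (by omega), ?_, ?_⟩
  · rintro G ⟨hG, hχ⟩
    rw [four_le_chromaticNumber_iff] at hχ
    have : Nonempty (Fin n) := ⟨⟨0, by omega⟩⟩
    have h1 := (graphIndex_spec G).2.1
    have h2 := (graphIndex_spec (F1 s t)).2.1
    have key : graphSpectralRadius (F1 s t) ≤ graphSpectralRadius G → Nonempty (G ≃g F1 s t) := by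
      intro hle
      refine nonempty_iso_F1_of_graphIndex_le (Fintype.card_fin n) hn hs' ht' hG hχ ?_
      rw [h1, h2] at hle
      exact (ENNReal.ofReal_le_ofReal_iff (graphIndex_spec G).1).1 hle
    refine ⟨?_, fun heq => key heq.ge, fun ⟨e⟩ => graphSpectralRadius_congr e⟩
    by_contra hlt
    push Not at hlt
    obtain ⟨e⟩ := key hlt.le
    exact hlt.ne (graphSpectralRadius_congr e).symm
  · rintro G ⟨hG, hχ⟩
    rw [four_le_chromaticNumber_iff] at hχ
    have h1 := card_edges_le_of_not_colorable (Fintype.card_fin n) (by omega) hG hχ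
    have h2 := card_edgeFinset_F1 s t
    rw [← hs', ← ht', ← h2] at h1
    rw [← G.coe_edgeFinset, ← (F1 s t).coe_edgeFinset, Set.ncard_coe_finset, Set.ncard_coe_finset]
    convert h1
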